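/- **Setting.** Let $E=(E^0,E^1,s,r)$ be a finite directed graph without sinks (every vertex emits an edge). A path of length $k$ is a word $\alpha=e_1\cdots e_k$ of edges with $s(e_j)=r(e_{j+1})$; put $s(\alpha)=s(e_k)$, $r(\alpha)=r(e_1)$; paths of length $0$ are the vertices. Let $A=c(E^0)$, and let $X_E^{\otimes k}$ be the $A$-correspondence of functions on the paths of length $k$, with $(a\xi)(\alpha)=a(r(\alpha))\xi(\alpha)$, $(\xi a)(\alpha)=\xi(\alpha)a(s(\alpha))$ and $\langle\xi,\eta\rangle(v)=\sum_{s(\alpha)=v}\overline{\xi(\alpha)}\eta(\alpha)$. Let $\mathcal F=\bigoplus_{k\ge0}X_E^{\otimes k}$ be the Fock correspondence, $\mathcal L(\mathcal F)$ its adjointable operators, $\mathcal K$ the closed span of the operators $\theta_{\xi,\eta}\zeta=\xi\langle\eta,\zeta\rangle$, and $q:\mathcal L(\mathcal F)\to\mathcal L(\mathcal F)/\mathcal K$ the quotient map. For $e\in E^1$ let $S_e\delta_\beta=\delta_{e\beta}$ (and $S_e\delta_\beta=0$ if $s(e)\ne r(\beta)$); for a path $\alpha=e_1\cdots e_n$,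 $n\geq 1$, let $u_\alpha=q(S_{e_1}\cdots S_{e_n})$. A weight sequence is a sequence $Z_k\in\mathcal L(X_E^{\otimes k})$ of positive invertible operators commuting with the left action of $A$, with $Z_0=I$, $\sup_k\|Z_k\|<\infty$, and $Z_k\ge\epsilon I$ for all $k\ge1$ and some $\epsilon>0$. Fix one, let $Z=\mathrm{diag}(Z_0,Z_1,\dots)$ and let $\mathcal T$ be the $C^*$-algebra generated by $\{ZS_e:e\in E^1\}$. Let $Q_k$ be the projection of $\mathcal F$ onto $X_E^{\otimes k}$, $W_t=\sum_k e^{ikt}Q_k$, $\gamma_t(X)=W_tXW_t^*$, $\mathcal D=\{X\in\mathcal T:\gamma_t(X)=X\ \forall t\in\mathbb R\}$, $F=\{X\in\mathcal T:\gamma_t(X)=e^{it}X\ \forall t\in\mathbb R\}$, and let $F^n$ be the linear span of the products of $n$ elements of $F$. Both $q(\mathcal D)$ and $q(F^n)$ are $C^*$-correspondences over $q(\mathcal D)$, with actions by multiplication and inner product $\langle x,y\rangle=x^*y$; an isomorphism of correspondences is a surjective linear bimodule map that preserves the inner product. $E$ is called irreducible if for any two vertices there is a path from one of them to the other (in at least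 one of the two directions). For $1\le l\le k$, $E=C_{k,l}$ means that $E^0=\{v_1,\dots,v_k\}$ and $E^1=\{e_1,\dots,e_k\}$ (distinct elements), with $e_i$ going from $v_i$ to $v_{i+1}$ for $i<k$ and $e_k$ from $v_k$ to $v_l$; such a graph is called a cycle with an entry. **Proposition.** Let $n\ge1$. (1) Suppose that $E$ is non-empty, irreducible, has no sources (every vertex receives an edge) and is not a cycle with an entry. Then there is no isomorphism of correspondences $w:q(\mathcal D)\to q(F^n)$. More generally, with sources allowed and without irreducibility, there is no such isomorphism if some vertex emits at least two edges and is the range of paths of every length. (2) Suppose that $E=C_{k,l}$. Then every $u_\alpha$ with $|\alpha|=n$ commutes with $q(\mathcal D)$ if and only if there is an isomorphism of correspondences $w:q(\mathcal D)\to q(F^n)$. -/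

import Mathlib

open scoped ComplexConjugate

noncomputable section

namespace WCK

/-- A directed graph with vertex set `V`, edge set `E`, source map `s` and range map `r`. -/
structure DGraph (V E : Type*) where
  s : E → V
  r : E → V

namespace DGraph

variable {V E : Type*} (G : DGraph V E)

/-- A vertex is a sink if it emits no edge. -/
def IsSink (v : V) : Prop := ∀ e, G.s e ≠ v

/-- A vertex is a source if it receives no edge. -/
def IsSource (v : V) : Prop := ∀ e, G.r e ≠ v

/-- A path `e₁ e₂ ⋯ eₙ` of length `n`, with `s eᵢ = r eᵢ₊₁`, recorded with the vertices
`r e₁, s e₁, …, s eₙ` that it visits; paths of length `0` are the vertices. -/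
@[ext]
structure Path (n : ℕ) where
  edge : Fin n → E
  vert : Fin (n + 1) → V
  r_edge : ∀ i, G.r (edge i) = vert i.castSucc
  s_edge : ∀ i, G.s (edge i) = vert i.succ

variable {G}

/-- The source `s(α) = s(eₙ)` of a path. -/
def Path.src {n : ℕ} (α : G.Path n) : V := α.vert (Fin.last n)

/-- The range `r(α) = r(e₁)` of a path. -/
def Path.rng {n : ℕ} (α : G.Path n) : V := α.vert 0

/-- The path `e₂ ⋯ eₙ₊₁` obtained from `e₁ e₂ ⋯ eₙ₊₁`. -/
def Path.tail {n : ℕ} (α : G.Path (n + 1)) : G.Path n where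
  edge i := α.edge i.succ
  vert i := α.vert i.succ
  r_edge i := α.r_edge i.succ
  s_edge i := α.s_edge i.succ

theorem Path.tail_injOn {n : ℕ} {α β : G.Path (n + 1)} (h0 : α.edge 0 = β.edge 0)
    (h : α.tail = β.tail) : α = β := by
  have he : ∀ i : Fin n, α.edge i.succ = β.edge i.succ := fun i =>
    congrFun (congrArg Path.edge h) i
  have hv : ∀ i : Fin (n + 1), α.vert i.succ = β.vert i.succ := fun i =>
    congrFun (congrArg Path.vert h) i
  ext i
  · exact Fin.cases h0 he i
  · refine Fin.cases ?_ hv i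
    have h1 := α.r_edge 0
    have h2 := β.r_edge 0
    rw [h0] at h1
    exact h1.symm.trans h2

instance [Finite V] [Finite E] (n : ℕ) : Finite (G.Path n) :=
  Finite.of_injective (fun α : G.Path n => (α.edge, α.vert)) fun α β h => by
    ext i
    · exact congrFun (congrArg Prod.fst h) i
    · exact congrFun (congrArg Prod.snd h) i

instance [Finite V] [Finite E] (n : ℕ) : Fintype (G.Path n) := Fintype.ofFinite _

variable (G)

/-- `G` is irreducible: of any two vertices, one can be reached from the other. -/
def Irreducible : Prop :=
  ∀ v w : V, (∃ (n : ℕ) (α : G.Path n), α.src = v ∧ α.rng = w) ∨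
    (∃ (n : ℕ) (α : G.Path n), α.src = w ∧ α.rng = v)

/-- `G` is the cycle with an entry `C_{k,l}`, `1 ≤ l ≤ k`: the vertices are `v₁, …, v_k`, the edges
are `e₁, …, e_k`, with `eᵢ : vᵢ → vᵢ₊₁` for `i < k` and `e_k : v_k → v_l`.
(The index `i : Fin k` stands for `i + 1`.) -/
def IsC (k l : ℕ) : Prop :=
  1 ≤ l ∧ l ≤ k ∧ ∃ (v : Fin k ≃ V) (e : Fin k ≃ E),
    (∀ i, G.s (e i) = v i) ∧
    (∀ i j : Fin k, (i : ℕ) + 1 = j → G.r (e i) = v j) ∧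
    (∀ i j : Fin k, (i : ℕ) + 1 = k → (j : ℕ) + 1 = l → G.r (e i) = v j)

/-- `G` is a cycle with an entry. -/
def IsCycleWithEntry : Prop := ∃ k l : ℕ, G.IsC k l

end DGraph

variable {V E : Type*} [Fintype V] [Fintype E]

/-! ### The correspondences `X_E^{⊗ k}` and the Fock correspondence -/

/-- The correspondence `X_E^{⊗ k} = X_{E^k}` over `A = c(E⁰)`: the functions on the paths of
length `k`. Its `A`-valued inner product is `levelInner`. As `E⁰` is finite, the norm of the
Hilbert `A`-module is equivalent to the `ℓ²` norm used here, and the two operator norms of an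
adjointable operator are equal. -/
abbrev Level (G : DGraph V E) (k : ℕ) : Type _ := EuclideanSpace ℂ (G.Path k)

/-- The Fock correspondence `⨁ₖ X_E^{⊗ k}`. A sequence `ξ` belongs to the direct sum of Hilbert
`A`-modules iff `∑ₖ ⟨ξₖ, ξₖ⟩` converges in `A = c(E⁰)`; as `E⁰` is finite this means
`∑ₖ ‖ξₖ‖² < ∞`. -/
abbrev Fock (G : DGraph V E) : Type _ := lp (fun k : ℕ => Level G k) 2

variable (G : DGraph V E)

/-- The `A`-valued inner product `⟨ξ, η⟩(v) = ∑_{s(β) = v} conj (ξ β) * η β` of `X_E^{⊗ k}`. -/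
def levelInner {k : ℕ} (ξ η : Level G k) : V → ℂ :=
  open Classical in
  fun v => ∑ β : G.Path k, if β.src = v then conj (ξ β) * η β else 0

/-- The `A`-valued inner product of the Fock correspondence. -/
def fockInner (ξ η : Fock G) : V → ℂ := fun v => ∑' k, levelInner G (ξ k) (η k) v

/-- `T` is adjointable with respect to the `A`-valued inner product `ip`. -/
def IsAdjointable {H : Type*} (ip : H → H → V → ℂ) (T : H → H) : Prop :=
  ∃ S : H → H, ∀ ξ η, ip (T ξ) η = ip ξ (S η)

/-- Pointwise multiplication by a function on the paths of length `k`. -/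
def mulBy {k : ℕ} (f : G.Path k → ℂ) : Level G k →L[ℂ] Level G k :=
  LinearMap.toContinuousLinearMap
    { toFun := fun ξ => WithLp.toLp 2 fun β => f β * ξ β
      map_add' := fun ξ η => by ext β; simp [mul_add]
      map_smul' := fun c ξ => by ext β; simp [mul_left_comm] }

@[simp]
theorem mulBy_apply {k : ℕ} (f : G.Path k → ℂ) (ξ : Level G k) (β : G.Path k) :
    mulBy G f ξ β = f β * ξ β := rfl

/-- The left action `(a · ξ)(β) = a(r(β)) ξ(β)` of `A` on `X_E^{⊗ k}`. -/
def levelLeft (k : ℕ) (a : V → ℂ) : Level G k →L[ℂ] Level G k := mulBy G fun β => a β.rng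

/-- The right action `(ξ · a)(β) = ξ(β) a(s(β))` of `A` on `X_E^{⊗ k}`. -/
def levelRight (k : ℕ) (a : V → ℂ) : Level G k →L[ℂ] Level G k := mulBy G fun β => a β.src

theorem norm_mulBy_le {k : ℕ} (f : G.Path k → ℂ) (C : ℝ) (hC : 0 ≤ C) (hf : ∀ β, ‖f β‖ ≤ C) :
    ‖mulBy G f‖ ≤ C := by
  refine ContinuousLinearMap.opNorm_le_bound _ hC fun ξ => ?_
  rw [EuclideanSpace.norm_eq, EuclideanSpace.norm_eq,
    show C = √(C ^ 2) from (Real.sqrt_sq hC).symm, ← Real.sqrt_mul (sq_nonneg C)]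
  refine Real.sqrt_le_sqrt ?_
  rw [Finset.mul_sum]
  refine Finset.sum_le_sum fun β _ => ?_
  rw [mulBy_apply, norm_mul, mul_pow]
  gcongr
  exact hf β

section diag

variable {G}

theorem diag_memℓp (T : ∀ k, Level G k →L[ℂ] Level G k) (h : ∃ C, ∀ k, ‖T k‖ ≤ C) (ξ : Fock G) :
    Memℓp (fun k => T k (ξ k)) 2 := by
  obtain ⟨C, hC⟩ := h
  refine ((lp.memℓp ξ).const_smul (C : ℂ)).mono' fun k => ?_
  have h0 : 0 ≤ C := (norm_nonneg _).trans (hC k)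
  rw [Pi.smul_apply, norm_smul, Complex.norm_real, Real.norm_of_nonneg h0]
  exact (T k).le_of_opNorm_le (hC k) _

/-- The diagonal operator `diag(T₀, T₁, …)` on the Fock correspondence, for a bounded sequence of
operators. -/
def diag (T : ∀ k, Level G k →L[ℂ] Level G k) (h : ∃ C, ∀ k, ‖T k‖ ≤ C) :
    Fock G →L[ℂ] Fock G :=
  LinearMap.mkContinuousOfExistsBound
    { toFun := fun ξ => ⟨fun k => T k (ξ k), diag_memℓp T h ξ⟩
      map_add' := fun ξ η => by ext1; funext k; exact map_add (T k) (ξ k) (η k)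
      map_smul' := fun c ξ => by ext1; funext k; exact map_smul (T k) c (ξ k) }
    (by
      obtain ⟨C, hC⟩ := h
      have h0 : 0 ≤ C := (norm_nonneg _).trans (hC 0)
      refine ⟨C, fun ξ => ?_⟩
      have key : ‖(C : ℂ) • ξ‖ = C * ‖ξ‖ := by
        rw [norm_smul, Complex.norm_real, Real.norm_of_nonneg h0]
      rw [← key]
      refine lp.norm_mono (by norm_num) fun k => ?_
      rw [lp.coeFn_smul, Pi.smul_apply, norm_smul, Complex.norm_real, Real.norm_of_nonneg h0]
      exact (T k).le_of_opNorm_le (hC k) _)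

@[simp]
theorem diag_apply (T : ∀ k, Level G k →L[ℂ] Level G k) (h : ∃ C, ∀ k, ‖T k‖ ≤ C) (ξ : Fock G)
    (k : ℕ) : diag T h ξ k = T k (ξ k) := rfl

end diag

/-- The right action of `A = c(E⁰)` on the Fock correspondence. -/
def fockRight (a : V → ℂ) : Fock G →L[ℂ] Fock G :=
  diag (fun k => levelRight G k a)
    ⟨‖a‖, fun _ => norm_mulBy_le G _ _ (norm_nonneg _) fun β => norm_le_pi_norm a β.src⟩

@[simp]
theorem fockRight_apply (a : V → ℂ) (ξ : Fock G) (k : ℕ) (β : G.Path k) :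
    fockRight G a ξ k β = a β.src * ξ k β := rfl

/-! ### Adjointable operators are the bounded maps commuting with the right action -/

theorem isAdjointable_iff {H : Type*} [NormedAddCommGroup H] [InnerProductSpace ℂ H]
    [CompleteSpace H] (ip : H → H → V → ℂ) (R : V → H →L[ℂ] H)
    (hip : ∀ ξ η v, ip ξ η v = inner ℂ (R v ξ) η) (hR : ∀ ξ, ∑ v, R v ξ = ξ) (T : H →L[ℂ] H) :
    IsAdjointable ip T ↔ ∀ v ξ, T (R v ξ) = R v (T ξ) := by
  constructor
  · rintro ⟨S, hS⟩ v ξ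
    have h1 : ∀ v ξ η, inner ℂ (R v (T ξ)) η = inner ℂ (R v ξ) (S η) := fun v ξ η => by
      rw [← hip, ← hip, hS]
    have h2 : ∀ ξ η, inner ℂ (T ξ) η = inner ℂ ξ (S η) := fun ξ η => by
      rw [← hR (T ξ), sum_inner]
      simp_rw [h1]
      rw [← sum_inner, hR]
    refine ext_inner_right ℂ fun η => ?_
    rw [h1, h2]
  · intro h
    refine ⟨T.adjoint, fun ξ η => funext fun v => ?_⟩
    rw [hip, hip, ← h, ContinuousLinearMap.adjoint_inner_right]

open Classical in
theorem levelInner_eq {k : ℕ} (ξ η : Level G k) (v : V) :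
    levelInner G ξ η v = inner ℂ (levelRight G k (Pi.single v 1) ξ) η := by
  simp only [levelInner, PiLp.inner_apply, levelRight, mulBy_apply, Pi.single_apply]
  refine Finset.sum_congr rfl fun β _ => ?_
  split_ifs <;> simp [mul_comm]

open Classical in
theorem fockInner_eq (ξ η : Fock G) (v : V) :
    fockInner G ξ η v = inner ℂ (fockRight G (Pi.single v 1) ξ) η := by
  rw [lp.inner_eq_tsum]
  exact tsum_congr fun k => levelInner_eq G _ _ v

open Classical in
theorem isAdjointable_level_iff {k : ℕ} (T : Level G k →L[ℂ] Level G k) :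
    IsAdjointable (levelInner G) T ↔
      ∀ v ξ, T (levelRight G k (Pi.single v 1) ξ) = levelRight G k (Pi.single v 1) (T ξ) := by
  refine isAdjointable_iff _ (fun v => levelRight G k (Pi.single v 1)) (levelInner_eq G) ?_ T
  intro ξ
  ext β
  simp [levelRight, Pi.single_apply]

open Classical in
theorem isAdjointable_fock_iff (T : Fock G →L[ℂ] Fock G) :
    IsAdjointable (fockInner G) T ↔
      ∀ v ξ, T (fockRight G (Pi.single v 1) ξ) = fockRight G (Pi.single v 1) (T ξ) := by
  refine isAdjointable_iff _ (fun v => fockRight G (Pi.single v 1)) (fockInner_eq G) ?_ T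
  intro ξ
  ext k β
  rw [lp.coeFn_sum, Finset.sum_apply, WithLp.ofLp_sum, Finset.sum_apply]
  simp [Pi.single_apply]

open Classical in
theorem fockRight_adjoint (v : V) :
    star (fockRight G (Pi.single v 1)) = fockRight G (Pi.single v 1) := by
  rw [ContinuousLinearMap.star_eq_adjoint, Eq.comm, ContinuousLinearMap.eq_adjoint_iff]
  intro ξ η
  rw [lp.inner_eq_tsum, lp.inner_eq_tsum]
  refine tsum_congr fun k => ?_
  simp only [PiLp.inner_apply, fockRight_apply, Pi.single_apply]
  refine Finset.sum_congr rfl fun β _ => ?_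
  split_ifs <;> simp

/-- The *-algebra of adjointable operators on the Fock correspondence, inside the bounded operators. -/
def adjointables : StarSubalgebra ℂ (Fock G →L[ℂ] Fock G) where
  carrier := {T | IsAdjointable (fockInner G) T}
  mul_mem' {S T} hS hT := by
    classical
    rw [Set.mem_ofPred_eq, isAdjointable_fock_iff] at *
    intro v ξ
    rw [mul_apply_eq_comp, hT, hS, mul_apply_eq_comp]
  add_mem' {S T} hS hT := by
    classical
    rw [Set.mem_ofPred_eq, isAdjointable_fock_iff] at *
    intro v ξ
    rw [add_apply, hT, hS, add_apply, map_add]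
  algebraMap_mem' c := by
    classical
    rw [Set.mem_ofPred_eq, isAdjointable_fock_iff]
    intro v ξ
    simp [Algebra.algebraMap_eq_smul_one]
  star_mem' {T} hT := by
    classical
    rw [Set.mem_ofPred_eq, isAdjointable_fock_iff] at *
    intro v ξ
    have h : T * fockRight G (Pi.single v 1) = fockRight G (Pi.single v 1) * T := by
      ext1 ξ
      exact hT v ξ
    have h' := congrArg star h
    rw [star_mul, star_mul, fockRight_adjoint] at h'
    exact (DFunLike.congr_fun h' ξ).symm

/-- `ℒ(ℱ(X_E))`: the C*-algebra of adjointable operators on the Fock correspondence. -/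
def Adj : Type _ := adjointables G

instance : NormedRing (Adj G) := inferInstanceAs (NormedRing (adjointables G))

instance : NormedAlgebra ℂ (Adj G) := inferInstanceAs (NormedAlgebra ℂ (adjointables G))

instance : StarRing (Adj G) := inferInstanceAs (StarRing (adjointables G))

instance : CStarRing (Adj G) := inferInstanceAs (CStarRing (adjointables G))

instance : StarModule ℂ (Adj G) := inferInstanceAs (StarModule ℂ (adjointables G))

variable {G} in
/-- An adjointable operator as a bounded operator. -/
def Adj.toCLM (X : Adj G) : Fock G →L[ℂ] Fock G := X.1

theorem diag_mem (T : ∀ k, Level G k →L[ℂ] Level G k) (h : ∃ C, ∀ k, ‖T k‖ ≤ C)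
    (hT : ∀ k, IsAdjointable (levelInner G) (T k)) : diag T h ∈ adjointables G := by
  classical
  refine (isAdjointable_fock_iff G _).2 fun v ξ => ?_
  ext1
  funext k
  exact (isAdjointable_level_iff G (T k)).1 (hT k) v (ξ k)

/-! ### Generalized compact operators and the quotient map -/

/-- `T` is the rank one operator `θ_{ξ,η} : ζ ↦ ξ · ⟨η, ζ⟩`. -/
def IsTheta (ξ η : Fock G) (T : Adj G) : Prop :=
  ∀ ζ, T.toCLM ζ = fockRight G (fockInner G η ζ) ξ

/-- The closed linear span of the operators `θ_{ξ,η}`. -/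
def compactsSubmodule : Submodule ℂ (Adj G) :=
  (Submodule.span ℂ {T | ∃ ξ η, IsTheta G ξ η T}).topologicalClosure


theorem fock_inner_theta (ξ η ζ ζ' : Fock G) :
    inner ℂ ζ (fockRight G (fockInner G η ζ') ξ) =
      inner ℂ (fockRight G (fockInner G ξ ζ) η) ζ' := by
  classical
  have key : ∀ (a : V → ℂ) (x : Fock G),
      fockRight G a x = ∑ v, a v • fockRight G (Pi.single v 1) x := by
    intro a x
    ext k β
    rw [lp.coeFn_sum, Finset.sum_apply, WithLp.ofLp_sum, Finset.sum_apply]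
    simp [Pi.single_apply]
  rw [key _ ξ, key _ η, inner_sum, sum_inner]
  refine Finset.sum_congr rfl fun v _ => ?_
  have h : ∀ x y : Fock G, inner ℂ (fockRight G (Pi.single v 1) x) y =
      inner ℂ x (fockRight G (Pi.single v 1) y) := fun x y => by
    rw [← ContinuousLinearMap.adjoint_inner_right, ← ContinuousLinearMap.star_eq_adjoint,
      fockRight_adjoint]
  rw [inner_smul_right, inner_smul_left, fockInner_eq, fockInner_eq, inner_conj_symm, ← h, mul_comm,
    h ζ ξ]

theorem IsTheta.star {ξ η : Fock G} {T : Adj G} (hT : IsTheta G ξ η T) :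
    IsTheta G η ξ (star T) := by
  intro ζ
  refine ext_inner_right ℂ fun ζ' => ?_
  change inner ℂ (ContinuousLinearMap.adjoint T.toCLM ζ) ζ' = _
  rw [ContinuousLinearMap.adjoint_inner_left, hT ζ', fock_inner_theta]

theorem IsTheta.mul_left {ξ η : Fock G} {T : Adj G} (hT : IsTheta G ξ η T) (X : Adj G) :
    IsTheta G (X.toCLM ξ) η (X * T) := by
  classical
  intro ζ
  have key : ∀ (a : V → ℂ) (x : Fock G),
      fockRight G a x = ∑ v, a v • fockRight G (Pi.single v 1) x := by
    intro a x
    ext k β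
    rw [lp.coeFn_sum, Finset.sum_apply, WithLp.ofLp_sum, Finset.sum_apply]
    simp [Pi.single_apply]
  have hX := (isAdjointable_fock_iff G X.toCLM).1 X.2
  change X.toCLM (T.toCLM ζ) = _
  rw [hT ζ, key _ ξ, key _ (X.toCLM ξ), map_sum]
  refine Finset.sum_congr rfl fun v _ => ?_
  rw [map_smul, hX]

theorem star_mem_compacts {X : Adj G} (hX : X ∈ compactsSubmodule G) :
    star X ∈ compactsSubmodule G := by
  refine map_mem_closure continuous_star hX fun Y hY => ?_
  induction hY using Submodule.span_induction with
  | mem x h =>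
    obtain ⟨ξ, η, h⟩ := h
    exact Submodule.subset_span ⟨η, ξ, h.star⟩
  | zero => simp
  | add x y _ _ hx hy => simpa using add_mem hx hy
  | smul a x _ hx => simpa using Submodule.smul_mem _ _ hx

theorem mul_mem_compacts (Y : Adj G) {X : Adj G} (hX : X ∈ compactsSubmodule G) :
    Y * X ∈ compactsSubmodule G := by
  refine map_mem_closure (f := fun X => Y * X) (continuous_const_mul Y) hX fun Z hZ => ?_
  induction hZ using Submodule.span_induction with
  | mem x h =>
    obtain ⟨ξ, η, h⟩ := h
    exact Submodule.subset_span ⟨_, η, h.mul_left G Y⟩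
  | zero => simp
  | add x y _ _ hx hy => simpa [mul_add] using add_mem hx hy
  | smul a x _ hx => simpa using Submodule.smul_mem _ _ hx

/-- The ideal `𝒦` of generalized compact operators in `ℒ(ℱ(X_E))`. -/
def compacts : Ideal (Adj G) where
  carrier := compactsSubmodule G
  add_mem' := fun h h' => add_mem h h'
  zero_mem' := zero_mem _
  smul_mem' := fun Y _ hX => mul_mem_compacts G Y hX

instance : (compacts G).IsTwoSided where
  mul_mem_of_left {X} Y hX := by
    have h := star_mem_compacts G (mul_mem_compacts G (star Y) (star_mem_compacts G hX))
    rw [star_mul, star_star, star_star] at h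
    exact h

/-- The quotient `ℒ(ℱ(X_E)) / 𝒦`. -/
def Calkin : Type _ := Adj G ⧸ compacts G

instance : Ring (Calkin G) := inferInstanceAs (Ring (Adj G ⧸ compacts G))

instance : Algebra ℂ (Calkin G) := inferInstanceAs (Algebra ℂ (Adj G ⧸ compacts G))

/-- The quotient map `ℒ(ℱ(X_E)) → ℒ(ℱ(X_E)) / 𝒦` as an algebra homomorphism. -/
def qAlg : Adj G →ₐ[ℂ] Calkin G := Ideal.Quotient.mkₐ ℂ (compacts G)

theorem qAlg_surjective : Function.Surjective (qAlg G) :=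
  Ideal.Quotient.mk_surjective

/-- The involution of `ℒ(ℱ(X_E)) / 𝒦`, induced by that of `ℒ(ℱ(X_E))`. -/
instance : Star (Calkin G) where
  star := Quotient.map' star fun X Y h => by
    rw [Submodule.quotientRel_def] at h ⊢
    have h' := star_mem_compacts G h
    rw [star_sub] at h'
    exact h'

theorem star_qAlg (X : Adj G) : star (qAlg G X) = qAlg G (star X) := rfl

instance : StarRing (Calkin G) where
  star_involutive x := by
    obtain ⟨X, rfl⟩ := qAlg_surjective G x
    rw [star_qAlg, star_qAlg, star_star]
  star_mul x y := by
    obtain ⟨X, rfl⟩ := qAlg_surjective G x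
    obtain ⟨Y, rfl⟩ := qAlg_surjective G y
    rw [← map_mul, star_qAlg, star_qAlg, star_qAlg, star_mul, map_mul]
  star_add x y := by
    obtain ⟨X, rfl⟩ := qAlg_surjective G x
    obtain ⟨Y, rfl⟩ := qAlg_surjective G y
    rw [← map_add, star_qAlg, star_qAlg, star_qAlg, star_add, map_add]

/-- The quotient map `q : ℒ(ℱ(X_E)) → ℒ(ℱ(X_E)) / 𝒦`. -/
def q : Adj G →⋆ₐ[ℂ] Calkin G :=
  { qAlg G with map_star' := fun X => (star_qAlg G X).symm }

/-! ### Shifts, weights and the weighted Toeplitz algebra -/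

/-- `ξ ↦ δ_e ⊗ ξ` from `X_E^{⊗ k}` to `X_E^{⊗ (k + 1)}`. -/
def levelShift (e : E) (k : ℕ) : Level G k →ₗ[ℂ] Level G (k + 1) :=
  open Classical in
  { toFun := fun ξ => WithLp.toLp 2 fun γ => if γ.edge 0 = e then ξ γ.tail else 0
    map_add' := fun ξ η => by ext γ; by_cases h : γ.edge 0 = e <;> simp [h]
    map_smul' := fun c ξ => by ext γ; by_cases h : γ.edge 0 = e <;> simp [h] }

theorem norm_levelShift_le (e : E) (k : ℕ) (ξ : Level G k) : ‖levelShift G e k ξ‖ ≤ ‖ξ‖ := by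
  classical
  rw [EuclideanSpace.norm_eq, EuclideanSpace.norm_eq]
  refine Real.sqrt_le_sqrt ?_
  have h1 : ∀ γ : G.Path (k + 1), ‖levelShift G e k ξ γ‖ ^ 2 =
      if γ.edge 0 = e then ‖ξ γ.tail‖ ^ 2 else 0 := fun γ => by
    by_cases h : γ.edge 0 = e <;> simp [levelShift, h]
  simp_rw [h1]
  rw [← Finset.sum_filter]
  have hinj : Set.InjOn (fun γ : G.Path (k + 1) => γ.tail)
      (Finset.univ.filter fun γ : G.Path (k + 1) => γ.edge 0 = e : Finset _) := by
    intro γ hγ γ' hγ' h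
    simp only [Finset.coe_filter, Finset.mem_univ, true_and] at hγ hγ'
    exact DGraph.Path.tail_injOn (hγ.trans hγ'.symm) h
  rw [← Finset.sum_image (f := fun β => ‖ξ β‖ ^ 2) hinj]
  exact Finset.sum_le_sum_of_subset_of_nonneg (Finset.subset_univ _) fun _ _ _ => by positivity

/-- The sequence `(0, δ_e ⊗ ξ₀, δ_e ⊗ ξ₁, …)`. -/
def shiftFun (e : E) (ξ : ∀ k, Level G k) : ∀ k, Level G k
  | 0 => 0
  | k + 1 => levelShift G e k (ξ k)

theorem shift_summable (e : E) (ξ : Fock G) :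
    Summable fun k => ‖shiftFun G e ξ k‖ ^ (2 : ENNReal).toReal := by
  rw [← summable_nat_add_iff 1]
  refine Summable.of_nonneg_of_le (fun k => by positivity) (fun k => ?_)
    ((lp.memℓp ξ).summable (by norm_num))
  exact Real.rpow_le_rpow (norm_nonneg _) (norm_levelShift_le G e k _) (by norm_num)

/-- The shift operator `S_e` on the Fock correspondence, as a bounded operator. -/
def shiftCLM (e : E) : Fock G →L[ℂ] Fock G :=
  LinearMap.mkContinuous
    { toFun := fun ξ => ⟨shiftFun G e ξ, memℓp_gen (shift_summable G e ξ)⟩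
      map_add' := fun ξ η => by
        ext1; funext k
        cases k with
        | zero => exact (add_zero (0 : Level G 0)).symm
        | succ k => exact map_add (levelShift G e k) (ξ k) (η k)
      map_smul' := fun c ξ => by
        ext1; funext k
        cases k with
        | zero => exact (smul_zero (A := Level G 0) c).symm
        | succ k => exact map_smul (levelShift G e k) c (ξ k) }
    1 fun ξ => by
      have hp : 0 < (2 : ENNReal).toReal := by norm_num
      rw [one_mul]
      refine (Real.rpow_le_rpow_iff (norm_nonneg _) (norm_nonneg _) hp).1 ?_
      rw [lp.norm_rpow_eq_tsum hp, lp.norm_rpow_eq_tsum hp]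
      refine (shift_summable G e ξ).tsum_eq_zero_add.trans_le ?_
      have h0 : ‖shiftFun G e ξ 0‖ ^ (2 : ENNReal).toReal = 0 := by simp [shiftFun]
      rw [h0, zero_add]
      refine Summable.tsum_le_tsum (fun k => ?_)
        ((summable_nat_add_iff 1).2 (shift_summable G e ξ)) ((lp.memℓp ξ).summable hp)
      exact Real.rpow_le_rpow (norm_nonneg _) (norm_levelShift_le G e k _) (by norm_num)

theorem shiftCLM_mem (e : E) : shiftCLM G e ∈ adjointables G := by
  classical
  refine (isAdjointable_fock_iff G _).2 fun v ξ => ?_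
  ext k γ
  cases k with
  | zero => exact (mul_zero _).symm
  | succ k =>
    change (if γ.edge 0 = e then _ * ξ k γ.tail else 0) =
      _ * (if γ.edge 0 = e then ξ k γ.tail else 0)
    rw [mul_ite, mul_zero]
    rfl

/-- The shift operator `S_e ∈ ℒ(ℱ(X_E))`, with `S_e δ_β = δ_{eβ}`. -/
def S (e : E) : Adj G := ⟨shiftCLM G e, shiftCLM_mem G e⟩

/-- `S_α = S_{α₁} ⋯ S_{αₙ}` for a path `α = α₁ ⋯ αₙ` of length `n ≥ 1`. -/
def SPath {n : ℕ} (α : G.Path n) : Adj G := (List.ofFn fun i => S G (α.edge i)).prod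

/-- `u_α = q(S_α)` for a path `α` of length `n ≥ 1`. -/
def u {n : ℕ} (α : G.Path n) : Calkin G := q G (SPath G α)

/-- A weight sequence: operators `Z_k ∈ ℒ(X_E^{⊗ k})` commuting with the left action of `A`, with
`Z₀ = I`, uniformly bounded, positive, invertible, and uniformly bounded below for `k ≥ 1`. -/
structure WeightSeq where
  op : ∀ k, Level G k →L[ℂ] Level G k
  adjointable : ∀ k, IsAdjointable (levelInner G) (op k)
  comm_left : ∀ k a, Commute (op k) (levelLeft G k a)
  op_zero : op 0 = 1
  bounded : ∃ C : ℝ, ∀ k, ‖op k‖ ≤ C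
  pos : ∀ k, (op k).IsPositive
  isUnit : ∀ k, IsUnit (op k)
  lower : ∃ ε : ℝ, 0 < ε ∧ ∀ k, 1 ≤ k → (op k - (ε : ℂ) • 1).IsPositive

variable {G}

/-- The weight operator `Z = diag(Z₀, Z₁, …)`. -/
def WeightSeq.Z (Z : WeightSeq G) : Adj G :=
  ⟨diag Z.op Z.bounded, diag_mem G Z.op Z.bounded Z.adjointable⟩

/-- The weighted Toeplitz algebra `𝒯(X_E, Z)`: the C*-algebra generated by the weighted shifts
`W_e = Z S_e`, `e ∈ E¹`. -/
def WeightSeq.T (Z : WeightSeq G) : NonUnitalStarSubalgebra ℂ (Adj G) :=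
  (NonUnitalStarAlgebra.adjoin ℂ (Set.range fun e : E => Z.Z * S G e)).topologicalClosure

/-! ### The gauge action, `𝒟` and `F` -/

theorem norm_phase (j : ℕ) (t : ℝ) : ‖Complex.exp (Complex.I * j * t)‖ = 1 := by
  have : Complex.I * j * t = ((j * t : ℝ) : ℂ) * Complex.I := by push_cast; ring
  rw [this, Complex.norm_exp_ofReal_mul_I]

variable (G) in
/-- The unitary `W_t = ∑ₙ e^{int} Qₙ`, where `Qₙ` is the projection onto the `n`-th summand. -/
def gaugeUnitary (t : ℝ) : Adj G :=
  ⟨diag (fun k => Complex.exp (Complex.I * k * t) • (1 : Level G k →L[ℂ] Level G k))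
      ⟨1, fun k => by
        rw [norm_smul, norm_phase, one_mul]
        exact ContinuousLinearMap.norm_id_le⟩,
    diag_mem G _ _ fun k => by
      classical
      refine (isAdjointable_level_iff G _).2 fun v ξ => ?_
      simp⟩

variable (G) in
/-- The gauge automorphism `γ_t = Ad(W_t)` of `ℒ(ℱ(X_E))`. -/
def gauge (t : ℝ) (X : Adj G) : Adj G := gaugeUnitary G t * X * star (gaugeUnitary G t)

theorem star_gaugeUnitary_mul (t : ℝ) : star (gaugeUnitary G t) * gaugeUnitary G t = 1 := by
  refine Subtype.ext ?_
  refine (ContinuousLinearMap.norm_map_iff_adjoint_comp_self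
    (gaugeUnitary G t).toCLM).1 fun ξ => ?_
  have hp : 0 < (2 : ENNReal).toReal := by norm_num
  rw [lp.norm_eq_tsum_rpow hp, lp.norm_eq_tsum_rpow hp]
  congr 1
  refine tsum_congr fun k => ?_
  change ‖Complex.exp (Complex.I * k * t) • ξ k‖ ^ _ = _
  rw [norm_smul, norm_phase, one_mul]

theorem gauge_mul (t : ℝ) (X Y : Adj G) : gauge G t (X * Y) = gauge G t X * gauge G t Y := by
  have h : gauge G t X * gauge G t Y = gaugeUnitary G t * X *
      (star (gaugeUnitary G t) * gaugeUnitary G t) * Y * star (gaugeUnitary G t) := by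
    simp only [gauge, mul_assoc]
  rw [h, star_gaugeUnitary_mul, mul_one, gauge]
  simp only [mul_assoc]

theorem gauge_add (t : ℝ) (X Y : Adj G) : gauge G t (X + Y) = gauge G t X + gauge G t Y := by
  simp only [gauge, mul_add, add_mul]

theorem gauge_smul (t : ℝ) (c : ℂ) (X : Adj G) : gauge G t (c • X) = c • gauge G t X := by
  simp only [gauge, mul_smul_comm, smul_mul_assoc]

theorem gauge_star (t : ℝ) (X : Adj G) : gauge G t (star X) = star (gauge G t X) := by
  simp only [gauge, star_mul, star_star, mul_assoc]

/-- `𝒟 = {X ∈ 𝒯(X_E, Z) : γ_t(X) = X for all t}`. -/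
def WeightSeq.D (Z : WeightSeq G) : NonUnitalStarSubalgebra ℂ (Adj G) where
  carrier := {X | X ∈ Z.T ∧ ∀ t : ℝ, gauge G t X = X}
  mul_mem' hX hY := ⟨mul_mem hX.1 hY.1, fun t => by rw [gauge_mul, hX.2, hY.2]⟩
  add_mem' hX hY := ⟨add_mem hX.1 hY.1, fun t => by rw [gauge_add, hX.2, hY.2]⟩
  zero_mem' := ⟨zero_mem _, fun t => by simp [gauge]⟩
  smul_mem' c _ hX := ⟨SMulMemClass.smul_mem c hX.1, fun t => by rw [gauge_smul, hX.2]⟩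
  star_mem' hX := ⟨star_mem hX.1, fun t => by rw [gauge_star, hX.2]⟩

/-- `F = {X ∈ 𝒯(X_E, Z) : γ_t(X) = e^{it} X for all t}`. -/
def WeightSeq.F (Z : WeightSeq G) : Submodule ℂ (Adj G) where
  carrier := {X | X ∈ Z.T ∧ ∀ t : ℝ, gauge G t X = Complex.exp (Complex.I * t) • X}
  add_mem' hX hY := ⟨add_mem hX.1 hY.1, fun t => by rw [gauge_add, hX.2, hY.2, smul_add]⟩
  zero_mem' := ⟨zero_mem _, fun t => by simp [gauge]⟩
  smul_mem' c _ hX :=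
    ⟨SMulMemClass.smul_mem c hX.1, fun t => by rw [gauge_smul, hX.2, smul_comm]⟩

/-- The algebra `q(𝒟)`. -/
def WeightSeq.qD (Z : WeightSeq G) : NonUnitalStarSubalgebra ℂ (Calkin G) :=
  NonUnitalStarSubalgebra.map (q G) Z.D

/-- The space `q(Fⁿ)`, where `Fⁿ` is the linear span of the products `a₁ ⋯ aₙ` with `aᵢ ∈ F`. -/
def WeightSeq.qFpow (Z : WeightSeq G) (n : ℕ) : Submodule ℂ (Calkin G) :=
  Submodule.map (q G).toAlgHom.toLinearMap (Z.F ^ n)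

/-- `w : q(𝒟) → q(Fⁿ)` is an isomorphism of correspondences over `q(𝒟)`: a surjective bimodule map
that preserves the inner product. Both inner products are `⟨x, y⟩ = x* y`, and the actions are given
by multiplication in `ℒ(ℱ(X_E)) / 𝒦`. -/
structure WeightSeq.IsCorrespondenceIso (Z : WeightSeq G) (n : ℕ)
    (w : Z.qD →ₗ[ℂ] Z.qFpow n) : Prop where
  surjective : Function.Surjective w
  map_left : ∀ a x : Z.qD, (w (a * x) : Calkin G) = (a : Calkin G) * (w x : Calkin G)
  map_right : ∀ x b : Z.qD, (w (x * b) : Calkin G) = (w x : Calkin G) * (b : Calkin G)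
  map_inner : ∀ x y : Z.qD,
    star (w x : Calkin G) * (w y : Calkin G) = star (x : Calkin G) * (y : Calkin G)

end WCK

end

/-!
Write `y = w(1)`. An isomorphism of correspondences `w : q(𝒟) → q(Fⁿ)` is left multiplication by
`y`, so it amounts to a unitary `y ∈ q(Fⁿ)` commuting with `q(𝒟)`. This uses `1 = ∑ q(Sₑ) q(Sₑ)*`
with `Sₑ ∈ 𝒯`: by functional calculus `Z⁻¹` is a limit of polynomials in `Z²`, and `Z²` maps the
elements of `𝒯` of positive range into `𝒯`, so `Sₑ = Z⁻¹(Z Sₑ) ∈ 𝒯`.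

If `Y ∈ Fⁿ` lifts `y`, then `1 - Y Y*` is compact, hence small on the summands of high degree, and
`Y*` is injective from degree `k + n` to degree `k` for large `k`. So the graph has at most as many
paths of length `k + n` as of length `k`, which is impossible when the number of paths is strictly
increasing.

If every vertex emits exactly one edge, a path is determined by its length and its source. Operators
of degree `0` are therefore diagonal in the basis of paths, so `q(𝒟)` is commutative. Moreover
`q(∑ₑ Sₑ)ⁿ` is a unitary in the span of the `u_α`, and it serves as `y` when the `u_α` commute with
`q(𝒟)`.
-/

noncomputable section

namespace WCK

namespace DGraph

variable {V E : Type*} {G : DGraph V E} {n : ℕ}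

theorem surjective_s (h : ∀ v, ¬ G.IsSink v) : Function.Surjective G.s := fun v => by
  simpa [IsSink] using h v

theorem surjective_r (h : ∀ v, ¬ G.IsSource v) : Function.Surjective G.r := fun v => by
  simpa [IsSource] using h v

theorem IsC.bijective_s {k l : ℕ} (h : G.IsC k l) : Function.Bijective G.s := by
  obtain ⟨-, -, v, e, hs, -⟩ := h
  have hs' : G.s = v ∘ e.symm := funext fun x => by simpa using hs (e.symm x)
  rw [hs']
  exact v.bijective.comp e.symm.bijective

/-- The path of length `0` at a vertex. -/
def Path.nil (v : V) : G.Path 0 where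
  edge := Fin.elim0
  vert _ := v
  r_edge i := i.elim0
  s_edge i := i.elim0

/-- The path `e α`, for an edge `e` with `s(e) = r(α)`. -/
def Path.cons (e : E) (α : G.Path n) (h : G.s e = α.rng) : G.Path (n + 1) where
  edge := Fin.cons e α.edge
  vert := Fin.cons (G.r e) α.vert
  r_edge := Fin.cases rfl α.r_edge
  s_edge := Fin.cases h α.s_edge

theorem Path.s_edge_zero (α : G.Path (n + 1)) : G.s (α.edge 0) = α.tail.rng := α.s_edge 0

theorem Path.src_zero_injective : Function.Injective (Path.src : G.Path 0 → V) := fun α β h => by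
  ext i
  · exact i.elim0
  · rwa [show i = Fin.last 0 from Subsingleton.elim (α := Fin 1) _ _]

theorem Path.tail_injective (hs : Function.Injective G.s) :
    Function.Injective (Path.tail : G.Path (n + 1) → G.Path n) := fun α β h =>
  Path.tail_injOn (hs (by rw [α.s_edge_zero, β.s_edge_zero, h])) h

theorem Path.tail_surjective (hs : Function.Surjective G.s) :
    Function.Surjective (Path.tail : G.Path (n + 1) → G.Path n) := fun α =>
  let ⟨e, he⟩ := hs α.rng
  ⟨Path.cons e α he, rfl⟩

theorem Path.src_injective (hs : Function.Injective G.s) :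
    ∀ n, Function.Injective (Path.src : G.Path n → V)
  | 0 => Path.src_zero_injective
  | n + 1 => (Path.src_injective hs n).comp (Path.tail_injective hs)

theorem Path.rng_eq_iterate {f : V → V} (hf : ∀ e, G.r e = f (G.s e)) :
    ∀ {n : ℕ} (α : G.Path n), α.rng = f^[n] α.src
  | 0, _ => rfl
  | n + 1, α => by
    have htail : α.tail.rng = f^[n] α.src := Path.rng_eq_iterate hf α.tail
    rw [Function.iterate_succ_apply', ← htail, ← α.s_edge_zero, ← hf]
    exact (α.r_edge 0).symm

theorem exists_path_rng_eq (hr : Function.Surjective G.r) (m : ℕ) (v : V) :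
    ∃ α : G.Path m, α.rng = v := by
  induction m generalizing v with
  | zero => exact ⟨Path.nil v, rfl⟩
  | succ m ih =>
    obtain ⟨e, rfl⟩ := hr v
    obtain ⟨α, hα⟩ := ih (G.s e)
    exact ⟨Path.cons e α hα.symm, rfl⟩

theorem strictMono_card_path [Finite V] [Finite E] (hs : Function.Surjective G.s) {e e' : E}
    (hee' : e ≠ e') (hss' : G.s e = G.s e') (hpath : ∀ m, ∃ α : G.Path m, α.rng = G.s e) :
    StrictMono fun m => Fintype.card (G.Path m) := by
  refine strictMono_nat_of_lt_succ fun m =>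
    Fintype.card_lt_of_surjective_not_injective Path.tail (Path.tail_surjective hs) fun hinj => ?_
  obtain ⟨α, hα⟩ := hpath m
  have hcons : Path.cons e α hα.symm = Path.cons e' α (hss' ▸ hα.symm) := hinj rfl
  exact hee' (congrArg (fun γ => γ.edge 0) hcons)

end DGraph

theorem bijective_pow_apply_of_isCycleOn {V : Type*} [Fintype V] {σ : Equiv.Perm V}
    (hσ : σ.IsCycleOn (Finset.univ : Finset V)) (v : V) :
    Function.Bijective fun i : Fin (Fintype.card V) => (σ ^ (i : ℕ)) v := by
  refine (Fintype.bijective_iff_surjective_and_card _).2 ⟨fun w => ?_, Fintype.card_fin _⟩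
  obtain ⟨i, hi, rfl⟩ := hσ.exists_pow_eq (Finset.mem_univ v) (Finset.mem_univ w)
  exact ⟨⟨i, hi⟩, rfl⟩

namespace DGraph

variable {V E : Type*} {G : DGraph V E}

theorem Irreducible.isCycleOn_univ [Fintype V] (hirr : G.Irreducible) {σ : Equiv.Perm V}
    (hσ : ∀ e, G.r e = σ (G.s e)) : σ.IsCycleOn (Finset.univ : Finset V) := by
  have hpath : ∀ {m} (α : G.Path m), σ.SameCycle α.src α.rng := fun {m} α =>
    ⟨m, by rw [Path.rng_eq_iterate hσ, zpow_natCast, Equiv.Perm.iterate_eq_pow]⟩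
  refine ⟨by simp, fun v _ w _ => ?_⟩
  rcases hirr v w with ⟨m, α, rfl, rfl⟩ | ⟨m, α, rfl, rfl⟩
  · exact hpath α
  · exact (hpath α).symm

theorem Irreducible.isCycleWithEntry [Finite V] [Nonempty V] (hirr : G.Irreducible)
    (hs : Function.Bijective G.s) (hr : Function.Surjective G.r) : G.IsCycleWithEntry := by
  have := Fintype.ofFinite V
  let s : E ≃ V := Equiv.ofBijective G.s hs
  have hsucc : Function.Bijective (G.r ∘ s.symm) :=
    Finite.surjective_iff_bijective.1 (hr.comp s.symm.surjective)
  let σ : Equiv.Perm V := Equiv.ofBijective _ hsucc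
  have hσ : ∀ e, G.r e = σ (G.s e) := fun e => (congrArg G.r (s.symm_apply_apply e)).symm
  have hcycle := hirr.isCycleOn_univ hσ
  obtain ⟨v₀⟩ := ‹Nonempty V›
  let v : Fin (Fintype.card V) ≃ V :=
    Equiv.ofBijective _ (bijective_pow_apply_of_isCycleOn hcycle v₀)
  have hr_edge : ∀ i, G.r (s.symm (v i)) = (σ ^ (i + 1 : ℕ)) v₀ := fun i => by
    rw [pow_succ']
    rfl
  refine ⟨Fintype.card V, 1, le_rfl, Fintype.card_pos_iff.2 ⟨v₀⟩, v, v.trans s.symm,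
    fun i => s.apply_symm_apply (v i), fun i j hij => ?_, fun i j hi hj => ?_⟩
  · rw [Equiv.trans_apply, hr_edge, hij]
    rfl
  · have hv : v j = v₀ := by simp [v, show (j : ℕ) = 0 by omega]
    rw [Equiv.trans_apply, hr_edge, hi, hv]
    exact hcycle.pow_card_apply (Finset.mem_univ v₀)

theorem Irreducible.exists_emits_two_and_exists_path_rng_eq [Finite V] [Nonempty V]
    (hirr : G.Irreducible) (hs : Function.Surjective G.s) (hr : Function.Surjective G.r)
    (hC : ¬ G.IsCycleWithEntry) :
    ∃ v, (∃ e e' : E, e ≠ e' ∧ G.s e = v ∧ G.s e' = v) ∧ ∀ m, ∃ α : G.Path m, α.rng = v := by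
  have hinj : ¬ Function.Injective G.s := fun hinj => hC (hirr.isCycleWithEntry ⟨hinj, hs⟩ hr)
  simp only [Function.Injective, not_forall] at hinj
  obtain ⟨e, e', hss', hee'⟩ := hinj
  exact ⟨G.s e', ⟨e, e', hee', hss', rfl⟩, fun m => exists_path_rng_eq hr m _⟩

end DGraph

section CStarAlgebra

variable {A : Type*}

/-- The star subalgebra of the elements `y` for which both `y` and `y*` map the subspace `J` into
itself by left multiplication. For closed `J` it is stable under the continuous functional
calculus. -/
def starStabilizer [Ring A] [StarRing A] [Algebra ℂ A] [StarModule ℂ A] (J : Submodule ℂ A) :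
    StarSubalgebra ℂ A where
  carrier := {y | ∀ b ∈ J, y * b ∈ J ∧ star y * b ∈ J}
  mul_mem' {x y} hx hy b hb := by
    rw [star_mul, mul_assoc, mul_assoc]
    exact ⟨(hx _ (hy b hb).1).1, (hy _ (hx b hb).2).2⟩
  add_mem' {x y} hx hy b hb := by
    rw [star_add, add_mul, add_mul]
    exact ⟨add_mem (hx b hb).1 (hy b hb).1, add_mem (hx b hb).2 (hy b hb).2⟩
  algebraMap_mem' c b hb := by
    rw [← algebraMap_star_comm, ← Algebra.smul_def, ← Algebra.smul_def]
    exact ⟨J.smul_mem _ hb, J.smul_mem _ hb⟩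
  star_mem' {y} hy b hb := by
    rw [star_star]
    exact (hy b hb).symm

theorem isClosed_starStabilizer [NormedRing A] [StarRing A] [NormedAlgebra ℂ A] [StarModule ℂ A]
    [ContinuousStar A] {J : Submodule ℂ A} (hJ : IsClosed (J : Set A)) :
    IsClosed (starStabilizer J : Set A) := by
  have hset : (starStabilizer J : Set A) =
      ⋂ b ∈ J, (fun y => y * b) ⁻¹' J ∩ (fun y => star y * b) ⁻¹' J := by
    ext y
    simp [starStabilizer]
  rw [hset]
  exact isClosed_biInter fun b _ =>
    (hJ.preimage (by fun_prop)).inter (hJ.preimage (by fun_prop))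

theorem exists_mul_eq_one_of_sq_mem [CStarAlgebra A] [PartialOrder A] [StarOrderedRing A]
    (M : StarSubalgebra ℂ A) [IsClosed (M : Set A)] {z : A} {δ : ℝ} (hδ : 0 < δ)
    (hz : algebraMap ℝ A δ ≤ z) (hsq : z ^ 2 ∈ M) : ∃ y ∈ M, y * z = 1 := by
  have hδ' : IsStrictlyPositive (algebraMap ℝ A δ) := isStrictlyPositive_algebraMap hδ
  have hz0 : 0 ≤ z := hδ'.nonneg.trans hz
  have hunit : IsUnit z := CStarAlgebra.isUnit_of_le _ hz hδ'
  have hzM : z ∈ M := by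
    have hsqrt : cfcₙ Real.sqrt (z ^ 2) ∈ M := cfcₙ_mem _ hsq
    rwa [← CFC.sqrt_eq_real_sqrt (z ^ 2) hz0.isSelfAdjoint.sq_nonneg, CFC.sqrt_sq z] at hsqrt
  lift z to M using hzM
  obtain ⟨y, hy⟩ := ((M.coe_isUnit).1 hunit).exists_left_inv
  exact ⟨y, y.2, congrArg Subtype.val hy⟩

end CStarAlgebra

variable {V E : Type*} [Fintype V] [Fintype E] {G : DGraph V E}

namespace Adj

@[ext]
theorem ext {X Y : Adj G} (h : ∀ ξ, X.toCLM ξ = Y.toCLM ξ) : X = Y :=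
  Subtype.ext (ContinuousLinearMap.ext h)

variable (G) in
/-- `Adj.toCLM` as a star algebra homomorphism. -/
def toCLMStarAlgHom : Adj G →⋆ₐ[ℂ] Fock G →L[ℂ] Fock G := (adjointables G).subtype

@[simp]
theorem toCLM_one : (1 : Adj G).toCLM = 1 := rfl

@[simp]
theorem toCLM_add (X Y : Adj G) : (X + Y).toCLM = X.toCLM + Y.toCLM := rfl

@[simp]
theorem toCLM_sub (X Y : Adj G) : (X - Y).toCLM = X.toCLM - Y.toCLM := rfl

@[simp]
theorem toCLM_mul (X Y : Adj G) : (X * Y).toCLM = X.toCLM * Y.toCLM := rfl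

@[simp]
theorem toCLM_smul (c : ℂ) (X : Adj G) : (c • X).toCLM = c • X.toCLM := rfl

@[simp]
theorem toCLM_star (X : Adj G) : (star X).toCLM = star X.toCLM := rfl

@[simp]
theorem toCLM_sum {ι : Type*} (s : Finset ι) (X : ι → Adj G) :
    (∑ i ∈ s, X i).toCLM = ∑ i ∈ s, (X i).toCLM :=
  map_sum (toCLMStarAlgHom G) X s

theorem isClosedEmbedding_toCLM :
    Topology.IsClosedEmbedding (toCLM : Adj G → Fock G →L[ℂ] Fock G) := by
  classical
  have hset : (adjointables G : Set (Fock G →L[ℂ] Fock G)) =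
      ⋂ (v : V) (ξ : Fock G), {T | T (fockRight G (Pi.single v 1) ξ) =
        fockRight G (Pi.single v 1) (T ξ)} := by
    ext T
    exact (isAdjointable_fock_iff G T).trans (by simp only [Set.mem_iInter, Set.mem_ofPred_eq])
  have hclosed : IsClosed (adjointables G : Set (Fock G →L[ℂ] Fock G)) := by
    rw [hset]
    exact isClosed_iInter fun v => isClosed_iInter fun ξ =>
      isClosed_eq (by fun_prop) (by fun_prop)
  exact hclosed.isClosedEmbedding_subtypeVal

end Adj

theorem fock_sum_apply {ι : Type*} (s : Finset ι) (ξ : ι → Fock G) (k : ℕ) :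
    (∑ i ∈ s, ξ i) k = ∑ i ∈ s, ξ i k := by
  rw [lp.coeFn_sum, Finset.sum_apply]

/-- The basis vector `δ_β` of the Fock correspondence. -/
def pathVec {k : ℕ} (β : G.Path k) : Fock G :=
  open Classical in lp.single 2 k (EuclideanSpace.single β 1)

theorem inner_pathVec_left {k : ℕ} (β : G.Path k) (ξ : Fock G) :
    inner ℂ (pathVec β) ξ = ξ k β := by
  classical
  simp [pathVec, lp.inner_single_left, EuclideanSpace.inner_single_left]

open Classical in
theorem S_apply_succ (e : E) (ξ : Fock G) (k : ℕ) (γ : G.Path (k + 1)) :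
    (S G e).toCLM ξ (k + 1) γ = if γ.edge 0 = e then ξ k γ.tail else 0 := rfl

theorem S_apply_zero (e : E) (ξ : Fock G) : (S G e).toCLM ξ 0 = 0 := rfl

theorem S_pathVec_tail {k : ℕ} (γ : G.Path (k + 1)) :
    (S G (γ.edge 0)).toCLM (pathVec γ.tail) = pathVec γ := by
  classical
  ext j γ'
  cases j with
  | zero => simp [S_apply_zero, pathVec]
  | succ j =>
    rw [S_apply_succ]
    by_cases hj : j = k
    · subst hj
      have hγ : γ' = γ ↔ γ'.edge 0 = γ.edge 0 ∧ γ'.tail = γ.tail :=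
        ⟨fun h => h ▸ ⟨rfl, rfl⟩, fun h => DGraph.Path.tail_injOn h.1 h.2⟩
      simp [pathVec, hγ, ite_and]
    · simp [pathVec, hj]

theorem star_S_apply_tail (ξ : Fock G) {k : ℕ} (γ : G.Path (k + 1)) :
    (star (S G (γ.edge 0))).toCLM ξ k γ.tail = ξ (k + 1) γ := by
  rw [← inner_pathVec_left, Adj.toCLM_star, ContinuousLinearMap.star_eq_adjoint,
    ContinuousLinearMap.adjoint_inner_right, S_pathVec_tail, inner_pathVec_left]

variable (G) in
/-- The operator `∑ₑ Sₑ Sₑ*`, which is the projection onto the summands of degree at least `1`. -/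
def rangeSum : Adj G := ∑ e : E, S G e * star (S G e)

theorem rangeSum_apply (ξ : Fock G) (k : ℕ) :
    (rangeSum G).toCLM ξ k = ∑ e, (S G e).toCLM ((star (S G e)).toCLM ξ) k := by
  rw [rangeSum, Adj.toCLM_sum, sum_apply, fock_sum_apply]
  rfl

theorem rangeSum_apply_zero (ξ : Fock G) : (rangeSum G).toCLM ξ 0 = 0 := by
  simp [rangeSum_apply, S_apply_zero]

theorem rangeSum_apply_succ (ξ : Fock G) (k : ℕ) :
    (rangeSum G).toCLM ξ (k + 1) = ξ (k + 1) := by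
  classical
  ext γ
  simp [rangeSum_apply, S_apply_succ, ← star_S_apply_tail ξ γ]

theorem rangeSum_mul_S (e : E) : rangeSum G * S G e = S G e := by
  ext ξ k γ
  cases k with
  | zero => simp [rangeSum_apply_zero, S_apply_zero]
  | succ k => simp [rangeSum_apply_succ]

open scoped ComplexOrder in
theorem isPositive_diag {T : ∀ k, Level G k →L[ℂ] Level G k} (h : ∃ C, ∀ k, ‖T k‖ ≤ C)
    (hT : ∀ k, (T k).IsPositive) : (diag T h).IsPositive := by
  refine (ContinuousLinearMap.isPositive_iff _).2 ⟨fun ξ η => ?_, fun ξ => ?_⟩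
  · simp only [ContinuousLinearMap.coe_coe, lp.inner_eq_tsum]
    exact tsum_congr fun k => (hT k).inner_left_eq_inner_right (ξ k) (η k)
  · rw [lp.inner_eq_tsum]
    exact tsum_nonneg fun k => (hT k).inner_nonneg_left (ξ k)

namespace WeightSeq

variable (Z : WeightSeq G)

theorem Z_apply (ξ : Fock G) (k : ℕ) : Z.Z.toCLM ξ k = Z.op k (ξ k) := rfl

theorem exists_algebraMap_le_Z : ∃ δ : ℝ, 0 < δ ∧ algebraMap ℝ _ δ ≤ Z.Z.toCLM := by
  obtain ⟨ε, hε, hlower⟩ := Z.lower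
  obtain ⟨C, hC⟩ := Z.bounded
  let δ := min ε 1
  have hpos : ∀ k, (Z.op k - (δ : ℂ) • 1).IsPositive := fun k => by
    rcases Nat.eq_zero_or_pos k with rfl | hk
    · rw [Z.op_zero, show (1 : Level G 0 →L[ℂ] Level G 0) - (δ : ℂ) • 1 = (1 - (δ : ℂ)) • 1 by
        module]
      refine ContinuousLinearMap.isPositive_one.smul_of_nonneg ?_
      exact_mod_cast sub_nonneg.2 (min_le_right ε 1)
    · rw [show Z.op k - (δ : ℂ) • 1 = (Z.op k - (ε : ℂ) • 1) + ((ε : ℂ) - δ) • 1 by module]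
      refine (hlower k hk).add (ContinuousLinearMap.isPositive_one.smul_of_nonneg ?_)
      exact_mod_cast sub_nonneg.2 (min_le_left ε 1)
  have hbound : ∀ k, ‖Z.op k - (δ : ℂ) • 1‖ ≤ C + ‖(δ : ℂ)‖ := fun k =>
    (norm_sub_le _ _).trans (add_le_add (hC k) <| (norm_smul (δ : ℂ) _).le.trans <|
      mul_le_of_le_one_right (norm_nonneg _) ContinuousLinearMap.norm_id_le)
  refine ⟨δ, lt_min hε one_pos, (ContinuousLinearMap.le_def _ _).2 ?_⟩
  convert isPositive_diag ⟨_, hbound⟩ hpos using 1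
  exact ContinuousLinearMap.ext fun ξ => Subtype.ext (funext fun k => rfl)

theorem Z_nonneg : 0 ≤ Z.Z.toCLM := (ContinuousLinearMap.nonneg_iff_isPositive _).2 <|
  isPositive_diag Z.bounded Z.pos

theorem star_Z : star Z.Z = Z.Z := Adj.ext fun ξ => by
  rw [Adj.toCLM_star, Z.Z_nonneg.isSelfAdjoint.star_eq]

theorem commute_rangeSum_Z : Commute (rangeSum G) Z.Z := by
  change rangeSum G * Z.Z = Z.Z * rangeSum G
  ext ξ k β
  cases k with
  | zero => simp [rangeSum_apply_zero, Z_apply]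
  | succ k => simp [rangeSum_apply_succ, Z_apply]

theorem Z_mul_S_mem_T (e : E) : Z.Z * S G e ∈ Z.T :=
  NonUnitalStarSubalgebra.le_topologicalClosure _ <|
    NonUnitalStarAlgebra.subset_adjoin ℂ _ ⟨e, rfl⟩

theorem isClosed_T : IsClosed (Z.T : Set (Adj G)) :=
  NonUnitalStarSubalgebra.isClosed_topologicalClosure _

/-- The subspace of the elements `b` of `𝒯` whose range has no component in degree `0`. It is stable
under left multiplication by `Z²`, because `Z² b = ∑ₑ (Z Sₑ) (Z Sₑ)* b`. -/
def positiveRange : Submodule ℂ (Adj G) :=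
  Z.T.toSubmodule ⊓ LinearMap.eqLocus (LinearMap.mulLeft ℂ (rangeSum G)) LinearMap.id

theorem mem_positiveRange {b : Adj G} : b ∈ Z.positiveRange ↔ b ∈ Z.T ∧ rangeSum G * b = b :=
  Iff.rfl

theorem isClosed_positiveRange : IsClosed (Z.positiveRange : Set (Adj G)) :=
  Z.isClosed_T.inter (isClosed_eq (continuous_const_mul _) continuous_id)

theorem Z_mul_S_mem_positiveRange (e : E) : Z.Z * S G e ∈ Z.positiveRange := by
  refine Z.mem_positiveRange.2 ⟨Z.Z_mul_S_mem_T e, ?_⟩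
  rw [← mul_assoc, Z.commute_rangeSum_Z.eq, mul_assoc, rangeSum_mul_S]

theorem Z_sq_mul_mem_positiveRange {b : Adj G} (hb : b ∈ Z.positiveRange) :
    Z.Z ^ 2 * b ∈ Z.positiveRange := by
  obtain ⟨hbT, hPb⟩ := Z.mem_positiveRange.1 hb
  have hsum : Z.Z ^ 2 * b = ∑ e, (Z.Z * S G e) * (star (Z.Z * S G e) * b) :=
    calc Z.Z ^ 2 * b = Z.Z * (Z.Z * (rangeSum G * b)) := by rw [hPb, sq, mul_assoc]
      _ = Z.Z * (rangeSum G * (Z.Z * b)) := by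
        rw [← mul_assoc Z.Z (rangeSum G), ← Z.commute_rangeSum_Z.eq, mul_assoc]
      _ = _ := by
        simp only [rangeSum, Finset.sum_mul, Finset.mul_sum, star_mul, Z.star_Z, mul_assoc]
  refine Z.mem_positiveRange.2 ⟨?_, ?_⟩
  · rw [hsum]
    exact sum_mem fun e _ =>
      mul_mem (Z.Z_mul_S_mem_T e) (mul_mem (star_mem (Z.Z_mul_S_mem_T e)) hbT)
  · rw [← mul_assoc, (Z.commute_rangeSum_Z.pow_right 2).eq, mul_assoc, hPb]

theorem Z_sq_mem_starStabilizer : Z.Z ^ 2 ∈ starStabilizer Z.positiveRange := fun b hb => by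
  rw [star_pow, Z.star_Z]
  exact ⟨Z.Z_sq_mul_mem_positiveRange hb, Z.Z_sq_mul_mem_positiveRange hb⟩

theorem S_mem_T (e : E) : S G e ∈ Z.T := by
  let M := (starStabilizer Z.positiveRange).map (Adj.toCLMStarAlgHom G)
  have hclosed : IsClosed (M : Set (Fock G →L[ℂ] Fock G)) :=
    Adj.isClosedEmbedding_toCLM.isClosedMap _ (isClosed_starStabilizer Z.isClosed_positiveRange)
  obtain ⟨δ, hδ, hle⟩ := Z.exists_algebraMap_le_Z
  obtain ⟨_, ⟨y, hy, rfl⟩, hyZ⟩ := exists_mul_eq_one_of_sq_mem M hδ hle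
    ⟨Z.Z ^ 2, Z.Z_sq_mem_starStabilizer, rfl⟩
  have hinv : y * Z.Z = 1 := Subtype.ext hyZ
  have hS : y * (Z.Z * S G e) = S G e := by rw [← mul_assoc, hinv, one_mul]
  rw [← hS]
  exact (Z.mem_positiveRange.1 (hy _ (Z.Z_mul_S_mem_positiveRange e)).1).1

end WeightSeq

/-! ### Generalized compact operators -/

section Compacts

open Filter Topology

variable (G) in
/-- The vacuum vector: the constant function `1` on the paths of length `0`. -/
def vacuum : Fock G := lp.single 2 0 (WithLp.toLp 2 fun _ => 1)

theorem vacuum_apply_zero (β : G.Path 0) : vacuum G 0 β = 1 := by simp [vacuum]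

theorem fockRight_single_vacuum [DecidableEq V] (v : V) :
    fockRight G (Pi.single v 1) (vacuum G) = pathVec (DGraph.Path.nil v) := by
  classical
  ext k β
  cases k with
  | zero =>
    have hβ : β.src = v ↔ β = DGraph.Path.nil v := DGraph.Path.src_zero_injective.eq_iff' rfl
    simp [vacuum, pathVec, Pi.single_apply, hβ]
  | succ k => simp [vacuum, pathVec]

theorem fockInner_vacuum (ζ : Fock G) (β : G.Path 0) :
    fockInner G (vacuum G) ζ β.src = ζ 0 β := by
  classical
  rw [fockInner_eq, fockRight_single_vacuum, inner_pathVec_left,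
    DGraph.Path.src_zero_injective (show (DGraph.Path.nil β.src).src = β.src from rfl)]

theorem isTheta_one_sub_rangeSum : IsTheta G (vacuum G) (vacuum G) (1 - rangeSum G) := by
  intro ζ
  ext k β
  rw [fockRight_apply]
  cases k with
  | zero => simp [fockInner_vacuum, vacuum_apply_zero, rangeSum_apply_zero]
  | succ k => simp [vacuum, rangeSum_apply_succ]

theorem q_eq_zero_iff {X : Adj G} : q G X = 0 ↔ X ∈ compacts G :=
  Ideal.Quotient.eq_zero_iff_mem

theorem q_rangeSum : q G (rangeSum G) = 1 := by
  have hmem : 1 - rangeSum G ∈ compacts G := Submodule.le_topologicalClosure _ <|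
    Submodule.subset_span ⟨_, _, isTheta_one_sub_rangeSum⟩
  rw [← q_eq_zero_iff, map_sub, map_one, sub_eq_zero] at hmem
  exact hmem.symm

theorem norm_levelRight_apply_le {k : ℕ} (a : V → ℂ) (x : Level G k) :
    ‖levelRight G k a x‖ ≤ ‖a‖ * ‖x‖ :=
  (levelRight G k a).le_of_opNorm_le
    (norm_mulBy_le G _ _ (norm_nonneg _) fun β => norm_le_pi_norm a β.src) x

theorem norm_fockRight_apply_le (a : V → ℂ) (ξ : Fock G) : ‖fockRight G a ξ‖ ≤ ‖a‖ * ‖ξ‖ := by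
  have hnorm : ‖(‖a‖ : ℂ) • ξ‖ = ‖a‖ * ‖ξ‖ := by
    rw [norm_smul, Complex.norm_real, norm_norm]
  rw [← hnorm]
  refine lp.norm_mono (by norm_num) fun k => ?_
  rw [lp.coeFn_smul, Pi.smul_apply, norm_smul, Complex.norm_real, norm_norm]
  exact norm_levelRight_apply_le a (ξ k)

theorem norm_fockInner_single_le (η : Fock G) (k : ℕ) (x : Level G k) :
    ‖fockInner G η (lp.single 2 k x)‖ ≤ ‖η k‖ * ‖x‖ := by
  classical
  refine (pi_norm_le_iff_of_nonneg (by positivity)).2 fun v => ?_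
  rw [fockInner_eq, lp.inner_single_right]
  refine (norm_inner_le_norm _ _).trans (mul_le_mul_of_nonneg_right ?_ (norm_nonneg x))
  change ‖levelRight G k (Pi.single v 1) (η k)‖ ≤ ‖η k‖
  simpa [Pi.norm_single] using norm_levelRight_apply_le (Pi.single v 1) (η k)

theorem tendsto_norm_apply (η : Fock G) : Tendsto (fun k => ‖η k‖) atTop (𝓝 0) := by
  simpa [Real.sqrt_sq] using ((lp.memℓp η).summable (by norm_num)).tendsto_atTop_zero.sqrt

/-- The restriction of an operator to the summand of degree `k`. -/
def restrictLevel (k : ℕ) : (Fock G →L[ℂ] Fock G) →ₗ[ℂ] Level G k →L[ℂ] Fock G where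
  toFun T := T ∘L lp.singleContinuousLinearMap ℂ _ 2 k
  map_add' _ _ := ContinuousLinearMap.add_comp _ _ _
  map_smul' _ _ := ContinuousLinearMap.smul_comp _ _ _

theorem restrictLevel_apply (k : ℕ) (T : Fock G →L[ℂ] Fock G) (x : Level G k) :
    restrictLevel k T x = T (lp.single 2 k x) := rfl

theorem norm_restrictLevel_le (k : ℕ) (T : Fock G →L[ℂ] Fock G) : ‖restrictLevel k T‖ ≤ ‖T‖ :=
  ContinuousLinearMap.opNorm_le_bound _ (norm_nonneg T) fun x => by
    simpa [restrictLevel_apply, lp.norm_single] using T.le_opNorm (lp.single 2 k x)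

variable (G) in
/-- The adjointable operators whose restrictions to the summands of degree `k` tend to `0` in norm
as `k → ∞`; the generalized compact operators are among them. -/
def vanishingAtInfinity : Submodule ℂ (Adj G) where
  carrier := {X | Tendsto (fun k => ‖restrictLevel k X.toCLM‖) atTop (𝓝 0)}
  zero_mem' := by simp [show (0 : Adj G).toCLM = 0 from rfl]
  add_mem' {X Y} hX hY := by
    refine squeeze_zero (fun _ => norm_nonneg _) (fun k => ?_) (by simpa using hX.add hY)
    rw [Adj.toCLM_add, map_add]
    exact norm_add_le _ _
  smul_mem' c X hX := by
    refine squeeze_zero (fun _ => norm_nonneg _) (fun k => ?_) (by simpa using hX.const_mul ‖c‖)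
    rw [Adj.toCLM_smul, map_smul, norm_smul]

theorem isClosed_vanishingAtInfinity : IsClosed (vanishingAtInfinity G : Set (Adj G)) := by
  refine isClosed_of_closure_subset fun X hX => Metric.tendsto_atTop.2 fun ε hε => ?_
  obtain ⟨Y, hY, hXY⟩ := Metric.mem_closure_iff.1 hX (ε / 2) (half_pos hε)
  obtain ⟨N, hN⟩ := Metric.tendsto_atTop.1 hY (ε / 2) (half_pos hε)
  refine ⟨N, fun k hk => ?_⟩
  have hYk : ‖restrictLevel k Y.toCLM‖ < ε / 2 := by simpa using hN k hk
  have hdiff : ‖restrictLevel k (X.toCLM - Y.toCLM)‖ < ε / 2 :=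
    (norm_restrictLevel_le k _).trans_lt (by rwa [dist_eq_norm] at hXY)
  rw [dist_zero_right, norm_norm]
  calc ‖restrictLevel k X.toCLM‖
      = ‖restrictLevel k (X.toCLM - Y.toCLM) + restrictLevel k Y.toCLM‖ := by
        rw [← map_add, sub_add_cancel]
    _ ≤ _ := norm_add_le _ _
    _ < ε := by linarith

theorem IsTheta.mem_vanishingAtInfinity {ξ η : Fock G} {T : Adj G} (hT : IsTheta G ξ η T) :
    T ∈ vanishingAtInfinity G := by
  refine squeeze_zero (fun _ => norm_nonneg _) (fun k => ?_)
    (by simpa using (tendsto_norm_apply η).mul_const ‖ξ‖)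
  refine ContinuousLinearMap.opNorm_le_bound _ (by positivity) fun x => ?_
  calc ‖restrictLevel k T.toCLM x‖ = ‖fockRight G (fockInner G η (lp.single 2 k x)) ξ‖ := by
        rw [restrictLevel_apply, hT]
    _ ≤ ‖fockInner G η (lp.single 2 k x)‖ * ‖ξ‖ := norm_fockRight_apply_le _ _
    _ ≤ ‖η k‖ * ‖x‖ * ‖ξ‖ := by gcongr; exact norm_fockInner_single_le η k x
    _ = ‖η k‖ * ‖ξ‖ * ‖x‖ := by ring

theorem compactsSubmodule_le_vanishingAtInfinity : compactsSubmodule G ≤ vanishingAtInfinity G :=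
  Submodule.topologicalClosure_minimal _
    (Submodule.span_le.2 fun _ ⟨_, _, hT⟩ => hT.mem_vanishingAtInfinity)
    isClosed_vanishingAtInfinity

end Compacts

/-! ### The sum of the shifts -/

variable (G) in
/-- The sum `∑ₑ Sₑ` of all the shift operators. -/
def shiftSum : Adj G := ∑ e : E, S G e

theorem shiftSum_apply (ξ : Fock G) (k : ℕ) :
    (shiftSum G).toCLM ξ k = ∑ e, (S G e).toCLM ξ k := by
  rw [shiftSum, Adj.toCLM_sum, sum_apply, fock_sum_apply]

theorem shiftSum_apply_zero (ξ : Fock G) : (shiftSum G).toCLM ξ 0 = 0 := by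
  simp [shiftSum_apply, S_apply_zero]

theorem shiftSum_apply_succ (ξ : Fock G) (k : ℕ) (γ : G.Path (k + 1)) :
    (shiftSum G).toCLM ξ (k + 1) γ = ξ k γ.tail := by
  classical
  simp [shiftSum_apply, S_apply_succ]

theorem shiftSum_pathVec_tail (hs : Function.Injective G.s) {k : ℕ} (γ : G.Path (k + 1)) :
    (shiftSum G).toCLM (pathVec γ.tail) = pathVec γ := by
  classical
  ext j γ'
  cases j with
  | zero => simp [shiftSum_apply_zero, pathVec]
  | succ j =>
    rw [shiftSum_apply_succ]
    by_cases hj : j = k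
    · subst hj
      simp [pathVec, (DGraph.Path.tail_injective hs).eq_iff]
    · simp [pathVec, hj]

theorem star_shiftSum_apply_tail (hs : Function.Injective G.s) (ξ : Fock G) {k : ℕ}
    (γ : G.Path (k + 1)) : (star (shiftSum G)).toCLM ξ k γ.tail = ξ (k + 1) γ := by
  rw [← inner_pathVec_left, Adj.toCLM_star, ContinuousLinearMap.star_eq_adjoint,
    ContinuousLinearMap.adjoint_inner_right, shiftSum_pathVec_tail hs, inner_pathVec_left]

theorem star_shiftSum_mul_shiftSum (hs : Function.Bijective G.s) :
    star (shiftSum G) * shiftSum G = 1 := by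
  ext ξ k β
  obtain ⟨γ, rfl⟩ := DGraph.Path.tail_surjective hs.2 β
  rw [Adj.toCLM_mul, mul_apply_eq_comp, star_shiftSum_apply_tail hs.1, shiftSum_apply_succ]
  rfl

theorem shiftSum_mul_star_shiftSum (hs : Function.Injective G.s) :
    shiftSum G * star (shiftSum G) = rangeSum G := by
  ext ξ k γ
  rw [Adj.toCLM_mul, mul_apply_eq_comp]
  cases k with
  | zero => rw [shiftSum_apply_zero, rangeSum_apply_zero]
  | succ k => rw [shiftSum_apply_succ, star_shiftSum_apply_tail hs, rangeSum_apply_succ]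

theorem q_shiftSum_mem_unitary (hs : Function.Bijective G.s) :
    q G (shiftSum G) ∈ unitary (Calkin G) := by
  rw [Unitary.mem_iff, ← map_star, ← map_mul, ← map_mul, star_shiftSum_mul_shiftSum hs,
    shiftSum_mul_star_shiftSum hs.1, map_one, q_rangeSum]
  exact ⟨rfl, rfl⟩

theorem SPath_succ {n : ℕ} (α : G.Path (n + 1)) :
    SPath G α = S G (α.edge 0) * SPath G α.tail := by
  rw [SPath, List.ofFn_succ, List.prod_cons]
  rfl

theorem S_mul_S_eq_zero {e f : E} (h : G.s e ≠ G.r f) : S G e * S G f = 0 := by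
  classical
  ext ξ k γ
  change (S G e).toCLM ((S G f).toCLM ξ) k γ = 0
  obtain _ | _ | k := k
  · rfl
  · simp [S_apply_succ, S_apply_zero]
  · rw [S_apply_succ, S_apply_succ, ite_eq_right_iff, ite_eq_right_iff]
    rintro rfl rfl
    exact absurd (γ.s_edge_zero.trans (γ.tail.r_edge 0).symm) h

theorem S_mul_SPath_mem_span {n : ℕ} (e : E) (α : G.Path (n + 1)) :
    S G e * SPath G α ∈ Submodule.span ℂ (Set.range (SPath G : G.Path (n + 2) → Adj G)) := by
  by_cases h : G.s e = α.rng
  · exact Submodule.subset_span ⟨DGraph.Path.cons e α h, SPath_succ _⟩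
  · rw [SPath_succ, ← mul_assoc, S_mul_S_eq_zero (by rwa [α.r_edge 0]), zero_mul]
    exact zero_mem _

theorem shiftSum_pow_succ_mem_span (n : ℕ) :
    shiftSum G ^ (n + 1) ∈ Submodule.span ℂ (Set.range (SPath G : G.Path (n + 1) → Adj G)) := by
  induction n with
  | zero =>
    rw [zero_add, pow_one]
    refine sum_mem fun e _ => Submodule.subset_span
      ⟨DGraph.Path.cons e (DGraph.Path.nil (G.s e)) rfl, ?_⟩
    rw [SPath_succ]
    exact mul_one _
  | succ n ih =>
    rw [pow_succ', shiftSum, Finset.sum_mul]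
    refine sum_mem fun e _ => ?_
    refine Submodule.span_le (p := (Submodule.span ℂ _).comap (LinearMap.mulLeft ℂ (S G e))).2 ?_ ih
    rintro _ ⟨α, rfl⟩
    exact S_mul_SPath_mem_span e α

/-! ### Homogeneous operators -/

theorem eq_zero_of_exp_smul_eq {M : Type*} [AddCommGroup M] [Module ℂ M] {a b : ℤ} (hab : a ≠ b)
    {x : M} (h : ∀ t : ℝ, Complex.exp (Complex.I * a * t) • x =
      Complex.exp (Complex.I * b * t) • x) : x = 0 := by
  have hab' : (a : ℂ) - b ≠ 0 := sub_ne_zero.2 (Int.cast_injective.ne hab)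
  let t : ℝ := Real.pi / ((a : ℝ) - b)
  have ht : Complex.I * a * t = Complex.I * b * t + Real.pi * Complex.I := by
    push_cast [t]
    field_simp
    ring
  have hx := h t
  rw [ht, Complex.exp_add, Complex.exp_pi_mul_I, mul_neg_one, neg_smul, neg_eq_iff_add_eq_zero,
    ← two_smul ℂ, smul_smul] at hx
  exact (smul_eq_zero.1 hx).resolve_left (mul_ne_zero two_ne_zero (Complex.exp_ne_zero _))

theorem gaugeUnitary_apply (t : ℝ) (ξ : Fock G) (k : ℕ) :
    (gaugeUnitary G t).toCLM ξ k = Complex.exp (Complex.I * k * t) • ξ k := rfl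

theorem gaugeUnitary_mul_star (t : ℝ) : gaugeUnitary G t * star (gaugeUnitary G t) = 1 := by
  have hneg : gaugeUnitary G t * gaugeUnitary G (-t) = 1 := Adj.ext fun ξ => Subtype.ext <|
    funext fun k => by simp [gaugeUnitary_apply, smul_smul, ← Complex.exp_add]
  rw [left_inv_eq_right_inv (star_gaugeUnitary_mul t) hneg, hneg]

theorem gaugeUnitary_single (t : ℝ) {m : ℕ} (x : Level G m) :
    (gaugeUnitary G t).toCLM (lp.single 2 m x) =
      Complex.exp (Complex.I * m * t) • lp.single 2 m x := by
  ext1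
  funext j
  rw [gaugeUnitary_apply, lp.coeFn_smul, Pi.smul_apply]
  by_cases hj : j = m
  · rw [hj]
  · rw [lp.single_apply_ne _ _ _ hj, smul_zero, smul_zero]

variable (G) in
/-- The operators that are homogeneous of degree `d` for the gauge action. -/
def homogeneous (d : ℤ) : Submodule ℂ (Adj G) where
  carrier := {X | ∀ t : ℝ, gauge G t X = Complex.exp (Complex.I * d * t) • X}
  add_mem' hX hY t := by rw [gauge_add, hX, hY, smul_add]
  zero_mem' t := by simp [gauge]
  smul_mem' c X hX t := by rw [gauge_smul, hX, smul_comm]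

theorem mem_homogeneous {d : ℤ} {X : Adj G} : X ∈ homogeneous G d ↔
    ∀ t : ℝ, gauge G t X = Complex.exp (Complex.I * d * t) • X := Iff.rfl

theorem mem_homogeneous_iff_gaugeUnitary_mul {d : ℤ} {X : Adj G} : X ∈ homogeneous G d ↔
    ∀ t : ℝ, gaugeUnitary G t * X =
      Complex.exp (Complex.I * d * t) • (X * gaugeUnitary G t) := by
  refine mem_homogeneous.trans (forall_congr' fun t => ⟨fun h => ?_, fun h => ?_⟩)
  · rw [← smul_mul_assoc, ← h, gauge, mul_assoc, star_gaugeUnitary_mul, mul_one]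
  · rw [gauge, h, smul_mul_assoc, mul_assoc X, gaugeUnitary_mul_star, mul_one]

theorem one_mem_homogeneous : 1 ∈ homogeneous G 0 :=
  mem_homogeneous_iff_gaugeUnitary_mul.2 fun t => by simp

theorem mul_mem_homogeneous {d d' : ℤ} {X Y : Adj G} (hX : X ∈ homogeneous G d)
    (hY : Y ∈ homogeneous G d') : X * Y ∈ homogeneous G (d + d') := fun t => by
  rw [gauge_mul, hX, hY, smul_mul_smul_comm, ← Complex.exp_add]
  congr 2
  push_cast
  ring

theorem star_mem_homogeneous {d : ℤ} {X : Adj G} (hX : X ∈ homogeneous G d) :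
    star X ∈ homogeneous G (-d) := fun t => by
  rw [gauge_star, hX, star_smul, RCLike.star_def, ← Complex.exp_conj]
  congr 2
  simp

theorem S_mem_homogeneous (e : E) : S G e ∈ homogeneous G 1 := by
  classical
  refine mem_homogeneous_iff_gaugeUnitary_mul.2 fun t => ?_
  ext ξ k γ
  cases k with
  | zero => simp [gaugeUnitary_apply, S_apply_zero]
  | succ k =>
    have hexp : Complex.exp (Complex.I * ((k + 1) * t)) =
        Complex.exp (Complex.I * t) * Complex.exp (Complex.I * (k * t)) := by
      rw [← Complex.exp_add]
      ring_nf
    simp [gaugeUnitary_apply, S_apply_succ, hexp, mul_assoc]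

theorem homogeneous_apply_single_eq_zero {d : ℤ} {X : Adj G} (hX : X ∈ homogeneous G d) {m k : ℕ}
    (hk : (k : ℤ) ≠ d + m) (x : Level G m) : X.toCLM (lp.single 2 m x) k = 0 := by
  refine eq_zero_of_exp_smul_eq hk fun t => ?_
  have hgauge := congrArg (fun Y : Adj G => Y.toCLM (lp.single 2 m x) k)
    (mem_homogeneous_iff_gaugeUnitary_mul.1 hX t)
  simp only [Adj.toCLM_mul, Adj.toCLM_smul, mul_apply_eq_comp, smul_apply, gaugeUnitary_apply,
    gaugeUnitary_single, map_smul, lp.coeFn_smul, Pi.smul_apply, smul_smul,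
    ← Complex.exp_add] at hgauge
  convert hgauge using 3 <;> push_cast <;> ring

theorem ext_pathVec {X Y : Adj G}
    (h : ∀ {k : ℕ} (β : G.Path k), X.toCLM (pathVec β) = Y.toCLM (pathVec β)) : X = Y := by
  refine star_injective (Adj.ext fun ξ => ?_)
  ext k β
  simp only [← inner_pathVec_left, Adj.toCLM_star, ContinuousLinearMap.star_eq_adjoint,
    ContinuousLinearMap.adjoint_inner_right, h]

theorem fockRight_src_pathVec [DecidableEq V] {k : ℕ} (β : G.Path k) :
    fockRight G (Pi.single β.src 1) (pathVec β) = pathVec β := by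
  classical
  ext m γ
  rw [fockRight_apply]
  by_cases hm : m = k
  · subst hm
    by_cases hγ : γ = β <;> simp [pathVec, hγ]
  · simp [pathVec, hm]

theorem exists_apply_pathVec_eq_smul (hs : Function.Injective G.s) {X : Adj G}
    (hX : X ∈ homogeneous G 0) {k : ℕ} (β : G.Path k) :
    ∃ c : ℂ, X.toCLM (pathVec β) = c • pathVec β := by
  classical
  refine ⟨X.toCLM (pathVec β) k β, ?_⟩
  have hright := (isAdjointable_fock_iff G X.toCLM).1 X.2 β.src (pathVec β)
  rw [fockRight_src_pathVec] at hright
  ext m γ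
  rw [lp.coeFn_smul, Pi.smul_apply, PiLp.smul_apply]
  by_cases hm : m = k
  · subst hm
    by_cases hγ : γ = β
    · simp [pathVec, hγ]
    · have hsrc : γ.src ≠ β.src := (DGraph.Path.src_injective hs m).ne hγ
      rw [hright, fockRight_apply, Pi.single_eq_of_ne hsrc]
      simp [pathVec, hγ]
  · rw [pathVec, homogeneous_apply_single_eq_zero hX (by simpa using hm)]
    simp [hm]

theorem mul_comm_of_mem_homogeneous_zero (hs : Function.Injective G.s) {X Y : Adj G}
    (hX : X ∈ homogeneous G 0) (hY : Y ∈ homogeneous G 0) : X * Y = Y * X := by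
  refine ext_pathVec fun β => ?_
  obtain ⟨c, hc⟩ := exists_apply_pathVec_eq_smul hs hX β
  obtain ⟨d, hd⟩ := exists_apply_pathVec_eq_smul hs hY β
  simp [hc, hd, smul_comm c d]

namespace WeightSeq

variable {Z : WeightSeq G} {n : ℕ} {X Y : Adj G}

theorem mem_D_iff : X ∈ Z.D ↔ X ∈ Z.T ∧ X ∈ homogeneous G 0 := by
  refine and_congr_right fun _ => forall_congr' fun t => ?_
  simp

theorem mem_F_iff : X ∈ Z.F ↔ X ∈ Z.T ∧ X ∈ homogeneous G 1 := by
  refine and_congr_right fun _ => forall_congr' fun t => ?_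
  simp

theorem F_pow_le_homogeneous : Z.F ^ n ≤ homogeneous G n := by
  induction n with
  | zero => simpa [Submodule.one_le] using one_mem_homogeneous
  | succ n ih =>
    rw [pow_succ, Nat.cast_succ]
    exact Submodule.mul_le.2 fun A hA B hB => mul_mem_homogeneous (ih hA) (mem_F_iff.1 hB).2

theorem F_pow_le_T (hn : n ≠ 0) : Z.F ^ n ≤ Z.T.toSubmodule := by
  induction n, Nat.one_le_iff_ne_zero.2 hn using Nat.le_induction with
  | base =>
    rw [pow_one]
    exact fun A hA => hA.1
  | succ n hn ih =>
    rw [pow_succ]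
    exact Submodule.mul_le.2 fun A hA B hB =>
      mul_mem (S := NonUnitalStarSubalgebra ℂ (Adj G)) (ih (by omega) hA) hB.1

theorem star_mul_mem_D (hn : n ≠ 0) (hX : X ∈ Z.F ^ n) (hY : Y ∈ Z.F ^ n) : star X * Y ∈ Z.D := by
  refine mem_D_iff.2 ⟨mul_mem (star_mem (F_pow_le_T hn hX)) (F_pow_le_T hn hY), ?_⟩
  simpa using mul_mem_homogeneous (star_mem_homogeneous (F_pow_le_homogeneous hX))
    (F_pow_le_homogeneous hY)

theorem mul_mem_F_of_mem_D (hX : X ∈ Z.F) (hY : Y ∈ Z.D) : X * Y ∈ Z.F :=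
  mem_F_iff.2 ⟨mul_mem hX.1 hY.1,
    by simpa using mul_mem_homogeneous (mem_F_iff.1 hX).2 (mem_D_iff.1 hY).2⟩

theorem mul_mem_F_pow_of_mem_D (hn : n ≠ 0) (hX : X ∈ Z.F ^ n) (hY : Y ∈ Z.D) :
    X * Y ∈ Z.F ^ n := by
  obtain ⟨m, rfl⟩ := Nat.exists_eq_succ_of_ne_zero hn
  rw [pow_succ] at hX ⊢
  refine Submodule.mul_induction_on hX (fun B hB C hC => ?_) fun B C hB hC => ?_
  · rw [mul_assoc]
    exact Submodule.mul_mem_mul hB (mul_mem_F_of_mem_D hC hY)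
  · rw [add_mul]
    exact add_mem hB hC

variable (Z)

theorem S_mem_F (e : E) : S G e ∈ Z.F := mem_F_iff.2 ⟨Z.S_mem_T e, S_mem_homogeneous e⟩

theorem rangeSum_mem_D : rangeSum G ∈ Z.D := by
  refine sum_mem fun e _ => mem_D_iff.2 ⟨mul_mem (Z.S_mem_T e) (star_mem (Z.S_mem_T e)), ?_⟩
  simpa using mul_mem_homogeneous (S_mem_homogeneous e) (star_mem_homogeneous (S_mem_homogeneous e))

theorem SPath_mem_F_pow : ∀ {n : ℕ} (α : G.Path n), SPath G α ∈ Z.F ^ n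
  | 0, _ => Submodule.one_le.1 (pow_zero Z.F).ge
  | n + 1, α => by
    rw [SPath_succ, pow_succ']
    exact Submodule.mul_mem_mul (Z.S_mem_F _) (SPath_mem_F_pow α.tail)

theorem shiftSum_pow_mem_F_pow (n : ℕ) : shiftSum G ^ n ∈ Z.F ^ n :=
  Submodule.pow_mem_pow _ (sum_mem fun e _ => Z.S_mem_F e) n

end WeightSeq

/-! ### Isomorphisms of correspondences and central unitaries -/

namespace WeightSeq

variable (Z : WeightSeq G) {n : ℕ}

theorem one_mem_qD : (1 : Calkin G) ∈ Z.qD := ⟨rangeSum G, Z.rangeSum_mem_D, q_rangeSum⟩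

theorem u_mem_qFpow (α : G.Path n) : u G α ∈ Z.qFpow n := ⟨SPath G α, Z.SPath_mem_F_pow α, rfl⟩

variable {Z}

theorem qD_mul_comm (hs : Function.Injective G.s) {a b : Calkin G} (ha : a ∈ Z.qD)
    (hb : b ∈ Z.qD) : a * b = b * a := by
  obtain ⟨A, hA, rfl⟩ := ha
  obtain ⟨B, hB, rfl⟩ := hb
  exact congrArg (q G) (mul_comm_of_mem_homogeneous_zero hs (mem_D_iff.1 hA).2 (mem_D_iff.1 hB).2)

theorem star_mul_mem_qD (hn : n ≠ 0) {y z : Calkin G} (hy : y ∈ Z.qFpow n) (hz : z ∈ Z.qFpow n) :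
    star y * z ∈ Z.qD := by
  obtain ⟨Y, hY, rfl⟩ := hy
  obtain ⟨X, hX, rfl⟩ := hz
  exact ⟨star Y * X, star_mul_mem_D hn hY hX, map_mul (q G) _ _⟩

theorem mul_mem_qFpow (hn : n ≠ 0) {y a : Calkin G} (hy : y ∈ Z.qFpow n) (ha : a ∈ Z.qD) :
    y * a ∈ Z.qFpow n := by
  obtain ⟨Y, hY, rfl⟩ := hy
  obtain ⟨A, hA, rfl⟩ := ha
  exact ⟨Y * A, mul_mem_F_pow_of_mem_D hn hY hA, map_mul (q G) _ _⟩

theorem eq_zero_of_mul_qFpow_eq_zero {p : Calkin G} (h : ∀ z ∈ Z.qFpow n, p * z = 0) : p = 0 := by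
  induction n with
  | zero => simpa using h 1 ⟨1, Submodule.one_le.1 (pow_zero Z.F).ge, map_one (q G)⟩
  | succ n ih =>
    refine ih ?_
    rintro _ ⟨X, hX, rfl⟩
    change p * q G X = 0
    calc p * q G X = ∑ e, p * q G (X * S G e) * q G (star (S G e)) := by
          rw [← mul_one (q G X), ← q_rangeSum, rangeSum, map_sum, Finset.mul_sum, Finset.mul_sum]
          simp only [map_mul, mul_assoc]
      _ = 0 := Finset.sum_eq_zero fun e _ => by
          have hXS : p * q G (X * S G e) = 0 :=
            h _ ⟨X * S G e, pow_succ Z.F n ▸ Submodule.mul_mem_mul hX (Z.S_mem_F e), rfl⟩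
          rw [hXS, zero_mul]

theorem IsCorrespondenceIso.exists_unitary {w : Z.qD →ₗ[ℂ] Z.qFpow n}
    (hw : Z.IsCorrespondenceIso n w) :
    ∃ y ∈ Z.qFpow n, y ∈ unitary (Calkin G) ∧ ∀ a ∈ Z.qD, y * a = a * y := by
  let e : Z.qD := ⟨1, Z.one_mem_qD⟩
  have hleft (a : Z.qD) : (w a : Calkin G) = a * w e := by
    rw [← hw.map_left, show a * e = a from Subtype.ext (mul_one _)]
  have hright (a : Z.qD) : (w a : Calkin G) = w e * a := by
    rw [← hw.map_right, show e * a = a from Subtype.ext (one_mul _)]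
  have hisometry : star (w e : Calkin G) * w e = 1 := by
    rw [hw.map_inner]
    simp [e]
  have hcoisometry : (w e : Calkin G) * star (w e : Calkin G) = 1 := by
    refine (sub_eq_zero.1 (eq_zero_of_mul_qFpow_eq_zero (Z := Z) (n := n) fun z hz => ?_)).symm
    obtain ⟨a, ha⟩ := hw.surjective ⟨z, hz⟩
    have hz' : z = w e * a := by rw [← hright, ha]
    rw [hz', sub_mul, one_mul, mul_assoc, ← mul_assoc (star _), hisometry, one_mul, sub_self]
  exact ⟨w e, (w e).2, Unitary.mem_iff.2 ⟨hisometry, hcoisometry⟩,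
    fun a ha => (hright ⟨a, ha⟩).symm.trans (hleft ⟨a, ha⟩)⟩

theorem exists_isCorrespondenceIso_of_unitary (hn : n ≠ 0) {y : Calkin G} (hy : y ∈ Z.qFpow n)
    (hyU : y ∈ unitary (Calkin G)) (hcomm : ∀ a ∈ Z.qD, y * a = a * y) :
    ∃ w : Z.qD →ₗ[ℂ] Z.qFpow n, Z.IsCorrespondenceIso n w := by
  let w : Z.qD →ₗ[ℂ] Z.qFpow n :=
    { toFun a := ⟨y * a, mul_mem_qFpow hn hy a.2⟩
      map_add' a b := Subtype.ext (mul_add y _ _)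
      map_smul' c a := Subtype.ext (mul_smul_comm c y _) }
  refine ⟨w, fun z => ⟨⟨star y * z, star_mul_mem_qD hn hy z.2⟩, Subtype.ext ?_⟩,
    fun a b => ?_, fun a b => (mul_assoc y _ _).symm, fun a b => ?_⟩
  · change y * (star y * z) = z
    rw [← mul_assoc, Unitary.mul_star_self_of_mem hyU, one_mul]
  · change y * (a * b) = a * (y * b)
    rw [← mul_assoc, hcomm a a.2, mul_assoc]
  · change star (y * a) * (y * b) = star (a : Calkin G) * b
    rw [star_mul, mul_assoc, ← mul_assoc (star y), Unitary.star_mul_self_of_mem hyU, one_mul]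

theorem exists_isCorrespondenceIso_iff (hn : n ≠ 0) :
    (∃ w : Z.qD →ₗ[ℂ] Z.qFpow n, Z.IsCorrespondenceIso n w) ↔
      ∃ y ∈ Z.qFpow n, y ∈ unitary (Calkin G) ∧ ∀ a ∈ Z.qD, y * a = a * y :=
  ⟨fun ⟨_, hw⟩ => hw.exists_unitary, fun ⟨_, hy, hyU, hcomm⟩ =>
    exists_isCorrespondenceIso_of_unitary hn hy hyU hcomm⟩

end WeightSeq

/-! ### Counting paths -/

open Filter in
theorem eventually_card_path_le {d : ℕ} {Y : Adj G} (hY : Y ∈ homogeneous G d)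
    (h : q G (Y * star Y) = 1) :
    ∀ᶠ k in atTop, Fintype.card (G.Path (k + d)) ≤ Fintype.card (G.Path k) := by
  have hcompact : 1 - Y * star Y ∈ compacts G := by
    rw [← q_eq_zero_iff, map_sub, map_one, h, sub_self]
  have hsmall : ∀ᶠ k in atTop, ‖restrictLevel (k + d) (1 - Y * star Y).toCLM‖ < 1 :=
    (tendsto_add_atTop_nat d).eventually <|
      (compactsSubmodule_le_vanishingAtInfinity hcompact).eventually_lt_const one_pos
  filter_upwards [hsmall] with k hk
  let f : Level G (k + d) →ₗ[ℂ] Level G k :=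
    { toFun x := (star Y).toCLM (lp.single 2 (k + d) x) k
      map_add' x x' := by rw [lp.single_add, map_add]; rfl
      map_smul' c x := by rw [lp.single_smul, map_smul]; rfl }
  have hf : Function.Injective f := (injective_iff_map_eq_zero f).2 fun x hx => by
    have hker : (star Y).toCLM (lp.single 2 (k + d) x) = 0 := by
      ext1
      funext j
      by_cases hj : j = k
      · subst hj
        exact hx
      · exact homogeneous_apply_single_eq_zero (star_mem_homogeneous hY) (by push_cast; omega) x
    have hfix : restrictLevel (k + d) (1 - Y * star Y).toCLM x = lp.single 2 (k + d) x := by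
      simp [-Adj.toCLM_star, restrictLevel_apply, hker]
    have hle := (restrictLevel (k + d) (1 - Y * star Y).toCLM).le_opNorm x
    rw [hfix, lp.norm_single (by norm_num)] at hle
    by_contra hx0
    exact hle.not_gt (mul_lt_of_lt_one_left (norm_pos_iff.2 hx0) hk)
  simpa using LinearMap.finrank_le_finrank_of_injective hf

namespace WeightSeq

variable {Z : WeightSeq G} {n : ℕ}

theorem not_exists_isCorrespondenceIso (hn : n ≠ 0)
    (hcard : StrictMono fun m => Fintype.card (G.Path m)) :
    ¬ ∃ w : Z.qD →ₗ[ℂ] Z.qFpow n, Z.IsCorrespondenceIso n w := by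
  rintro ⟨w, hw⟩
  obtain ⟨_, ⟨Y, hY, rfl⟩, hU, -⟩ := hw.exists_unitary
  have hYY : q G (Y * star Y) = 1 := by
    rw [map_mul, map_star]
    exact Unitary.mul_star_self_of_mem hU
  obtain ⟨k, hk⟩ := (eventually_card_path_le (F_pow_le_homogeneous hY) hYY).exists
  exact hk.not_gt (hcard (show k < k + n by omega))

/-! ### Graphs in which every vertex emits exactly one edge -/

theorem q_shiftSum_pow_mul_comm (hn : n ≠ 0) {a : Calkin G}
    (h : ∀ α : G.Path n, u G α * a = a * u G α) :
    q G (shiftSum G ^ n) * a = a * q G (shiftSum G ^ n) := by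
  obtain ⟨m, rfl⟩ := Nat.exists_eq_succ_of_ne_zero hn
  refine Submodule.span_induction (p := fun X _ => q G X * a = a * q G X) ?_ (by simp)
    (fun X Y _ _ hX hY => by rw [map_add, add_mul, mul_add, hX, hY])
    (fun c X _ hX => by rw [map_smul, smul_mul_assoc, mul_smul_comm, hX])
    (shiftSum_pow_succ_mem_span m)
  rintro _ ⟨α, rfl⟩
  exact h α

theorem exists_isCorrespondenceIso_iff_forall_u_mul_comm (hs : Function.Bijective G.s)
    (hn : n ≠ 0) : (∃ w : Z.qD →ₗ[ℂ] Z.qFpow n, Z.IsCorrespondenceIso n w) ↔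
      ∀ α : G.Path n, ∀ a ∈ Z.qD, u G α * a = a * u G α := by
  rw [exists_isCorrespondenceIso_iff hn]
  constructor
  · rintro ⟨y, hy, hyU, hcomm⟩ α a ha
    let b := star y * u G α
    have hb : b ∈ Z.qD := star_mul_mem_qD hn hy (Z.u_mem_qFpow α)
    have hu : u G α = y * b := by
      rw [← mul_assoc, Unitary.mul_star_self_of_mem hyU, one_mul]
    rw [hu, mul_assoc, qD_mul_comm hs.1 hb ha, ← mul_assoc, hcomm a ha, mul_assoc]
  · intro hcomm
    refine ⟨q G (shiftSum G ^ n), ⟨_, Z.shiftSum_pow_mem_F_pow n, rfl⟩, ?_,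
      fun a ha => q_shiftSum_pow_mul_comm hn fun α => hcomm α a ha⟩
    rw [map_pow]
    exact pow_mem (q_shiftSum_mem_unitary hs) n

end WeightSeq

end WCK

end

theorem mainTheorem10_general {V E : Type*} [Fintype V] [Fintype E] (G : WCK.DGraph V E)
    (hsink : ∀ v, ¬ G.IsSink v) (Z : WCK.WeightSeq G) (n : ℕ) (hn : 1 ≤ n) :
    ((∃ v, (∃ e e' : E, e ≠ e' ∧ G.s e = v ∧ G.s e' = v) ∧ ∀ m, ∃ α : G.Path m, α.rng = v) →
      ¬ ∃ w : Z.qD →ₗ[ℂ] Z.qFpow n, Z.IsCorrespondenceIso n w) ∧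
    (Function.Injective G.s →
      ((∀ α : G.Path n, ∀ a ∈ Z.qD, WCK.u G α * a = a * WCK.u G α) ↔
        ∃ w : Z.qD →ₗ[ℂ] Z.qFpow n, Z.IsCorrespondenceIso n w)) := by
  have hs : Function.Surjective G.s := WCK.DGraph.surjective_s hsink
  have hn' : n ≠ 0 := Nat.one_le_iff_ne_zero.1 hn
  refine ⟨?_, fun hinj => ?_⟩
  · rintro ⟨_, ⟨e, e', hee', rfl, hss'⟩, hpath⟩
    exact WCK.WeightSeq.not_exists_isCorrespondenceIso hn'
      (WCK.DGraph.strictMono_card_path hs hee' hss'.symm hpath)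
  · exact (WCK.WeightSeq.exists_isCorrespondenceIso_iff_forall_u_mul_comm ⟨hinj, hs⟩ hn').symm

theorem mainTheorem10 {V E : Type*} [Fintype V] [Fintype E] (G : WCK.DGraph V E)
    (hsink : ∀ v, ¬ G.IsSink v) (Z : WCK.WeightSeq G) (n : ℕ) (hn : 1 ≤ n) :
    -- no isomorphism if `G` is irreducible, without sources and not a cycle with an entry
    ((Nonempty V ∧ (∀ v, ¬ G.IsSource v) ∧ G.Irreducible ∧ ¬ G.IsCycleWithEntry) →
      ¬ ∃ w : Z.qD →ₗ[ℂ] Z.qFpow n, Z.IsCorrespondenceIso n w) ∧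
    -- sources allowed: no isomorphism if a vertex emitting two edges is the range of paths of
    -- every length
    ((∃ v, (∃ e e' : E, e ≠ e' ∧ G.s e = v ∧ G.s e' = v) ∧ ∀ m, ∃ α : G.Path m, α.rng = v) →
      ¬ ∃ w : Z.qD →ₗ[ℂ] Z.qFpow n, Z.IsCorrespondenceIso n w) ∧
    -- the case of a cycle with an entry
    (∀ k l : ℕ, G.IsC k l →
      ((∀ α : G.Path n, ∀ a ∈ Z.qD, WCK.u G α * a = a * WCK.u G α) ↔
        ∃ w : Z.qD →ₗ[ℂ] Z.qFpow n, Z.IsCorrespondenceIso n w)) := by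
  obtain ⟨hbranching, hinjective⟩ := mainTheorem10_general G hsink Z n hn
  exact ⟨fun ⟨_, hsource, hirr, hcycle⟩ => hbranching <|
      hirr.exists_emits_two_and_exists_path_rng_eq (WCK.DGraph.surjective_s hsink)
        (WCK.DGraph.surjective_r hsource) hcycle,
    hbranching, fun _ _ hC => hinjective hC.bijective_s.injective⟩
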